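/- Let $S$ be a closed (compact, boundaryless) smooth surface with a smooth Riemannian metric, and let $\mu$ be a volume probability measure on $S$, i.e. $\mu=\rho\,dA$ with $dA$ the Riemannian area and $\rho>0$ smooth. For a $C^1$ local diffeomorphism $f:S\to S$ write $|\det df^n_y|$ for the Jacobian of $f^n$ at $y$ with respect to $\mu$, and for $x\in S$, $0\neq v\in T_xS$, $n\ge1$ put $$I(x,v,f^n)=\sum_{f^n(y)=x}\frac{\log\|(df^n_y)^{-1}v\|}{|\det df^n_y|},\qquad C(f)=\sup_{n\ge1}\frac1n\inf_{x\in S,\ v\in T_xS,\ \|v\|=1}I(x,v,f^n).$$ Let $\mathcal U$ be the set of $C^1$ endomorphisms (local diffeomorphisms) $f$ of $S$ that preserve $\mu$ and satisfy $C(f)>0$. For $f\in\mathcal U$ let $\widehat S=\{\widehat x=(x_n)_{n\in\mathbb Z}: f(x_{n-1})=x_n\ \forall n\in\mathbb Z\}$ be the natural extension, with the $\sigma$-algebra generated by the coordinates, and let $\vartheta(\widehat x)=x_0$. Let $\widehat\mu$ be the lift of $\mu$, i.e. the unique probability measure on $\widehat S$ with $\widehat\mu\{x_n\in B\}=\mu(B)$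 for all Borel $B\subset S$ and $n\le0$, and let $\widehat\mu=\int\mu^-_x\,d\mu(x)$ be its disintegration into probability measures $\mu_x^-$ on the sets $\vartheta^{-1}(x)$ of pre-orbits of $x$. For $\widehat x\in\widehat S$ and $n\ge0$ write $\widehat{df}^{(-n)}_{\widehat x}=(df^n_{x_{-n}})^{-1}:T_{x_0}S\to T_{x_{-n}}S$, and let $$E^u_{\widehat x}=\{v\in T_{x_0}S:\ \exists\, C\in\mathbb R,\ c>0\ \ \forall n\ge0\ \ \|\widehat{df}^{(-n)}_{\widehat x}v\|\le Ce^{-cn}\}$$ be the unstable space. **Theorem.** For every $f\in\mathcal U$ there are constants $A,\beta>0$ such that for $\mu$-a.e. $x\in S$ the following holds: for $\mu^-_x$-a.e. $\widehat x$ the space $E^u_{\widehat x}$ is a line (the unstable direction), and for every line $E\in\mathbb P T_xS$ and every $\eta>0$, $$\mu^-_x\{\widehat x:\ \angle(E,E^u_{\widehat x})<\eta\}\le A\,\eta^\beta ,$$ where $\angle\in[0,\pi/2]$ is the angle between lines. -/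

import Mathlib

open MeasureTheory ProbabilityTheory Bundle
open scoped Manifold ContDiff Bundle LinearAlgebra.Projectivization

noncomputable section

namespace UnstableAngle

/-- The Euclidean plane, on which surfaces are modelled. -/
abbrev Plane : Type := EuclideanSpace ℝ (Fin 2)

/-- The Jacobian `√(det (Lᵀ L))` of a linear map between Euclidean spaces.  When both spaces have
the same dimension this is `|det L|`, computed in orthonormal bases. -/
def jacobian {V W : Type*} [NormedAddCommGroup V] [InnerProductSpace ℝ V] [FiniteDimensional ℝ V]
    [NormedAddCommGroup W] [InnerProductSpace ℝ W] [FiniteDimensional ℝ W]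
    (L : V →ₗ[ℝ] W) : ℝ :=
  Real.sqrt (LinearMap.det (LinearMap.adjoint L ∘ₗ L))

/-- The (unoriented) angle, in `[0, π/2]`, between two lines of a Euclidean space. -/
def lineAngle {V : Type*} [NormedAddCommGroup V] [InnerProductSpace ℝ V] (E F : ℙ ℝ V) : ℝ :=
  Real.arccos (|inner ℝ E.rep F.rep| / (‖E.rep‖ * ‖F.rep‖))

section Surface

variable {S : Type*} [TopologicalSpace S] [ChartedSpace Plane S]

instance (x : S) : FiniteDimensional ℝ (TangentSpace (𝓡 2) x) :=
  inferInstanceAs (FiniteDimensional ℝ Plane)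

variable [RiemannianBundle (fun x : S => TangentSpace (𝓡 2) x)]

/-- The identification of the tangent spaces at two equal points. -/
def tangentCast {x y : S} (h : x = y) :
    TangentSpace (𝓡 2) x ≃ₗᵢ[ℝ] TangentSpace (𝓡 2) y :=
  h ▸ LinearIsometryEquiv.refl ℝ (TangentSpace (𝓡 2) x)

/-- `μ` is the measure `ρ · dA`, where `dA` is the area of the Riemannian metric and `ρ` is a smooth
positive function: in each chart `φ`, the set `B` has measure
`∫_{φ(B)} ρ(φ⁻¹ z) J(d(φ⁻¹)_z) dz`. Here `J(d(φ⁻¹)_z)` equals `√(det (g_ij(z)))`. -/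
structure IsSmoothVolume [MeasurableSpace S] (ρ : S → ℝ) (μ : Measure S) : Prop where
  contMDiff : ContMDiff (𝓡 2) 𝓘(ℝ, ℝ) ∞ ρ
  pos : ∀ x, 0 < ρ x
  measure_eq : ∀ (p : S) (B : Set S), MeasurableSet B → B ⊆ (chartAt Plane p).source →
    μ B = ∫⁻ z in chartAt Plane p '' B,
      ENNReal.ofReal (ρ ((chartAt Plane p).symm z) *
        jacobian (V := Plane) (W := TangentSpace (𝓡 2) ((chartAt Plane p).symm z))
          (mfderiv (𝓡 2) (𝓡 2) (chartAt Plane p).symm z : Plane →L[ℝ] _).toLinearMap)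

/-- `|det df_y|`, the Jacobian of `f` at `y` with respect to the volume `ρ · dA`. -/
def absDet (ρ : S → ℝ) (f : S → S) (y : S) : ℝ :=
  ρ (f y) / ρ y * jacobian (mfderiv (𝓡 2) (𝓡 2) f y).toLinearMap

/-- For `f^n(y) = x`, the vector `(df^n_y)⁻¹ v` of `T_y S`, where `v ∈ T_x S`. -/
def pullBack (f : S → S) (n : ℕ) {x y : S} (h : f^[n] y = x) (v : TangentSpace (𝓡 2) x) :
    TangentSpace (𝓡 2) y :=
  (mfderiv (𝓡 2) (𝓡 2) f^[n] y).inverse (tangentCast h.symm v)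

/-- `I(x, v, f^n) = ∑_{f^n(y) = x} log ‖(df^n_y)⁻¹ v‖ / |det df^n_y|`. -/
def pastExpansion (ρ : S → ℝ) (f : S → S) (n : ℕ) (x : S) (v : TangentSpace (𝓡 2) x) : ℝ :=
  ∑' y : {y : S // f^[n] y = x}, Real.log ‖pullBack f n y.2 v‖ / absDet ρ f^[n] y

/-- `C(f) = sup_{n ≥ 1} (1/n) inf_{x, ‖v‖ = 1} I(x, v, f^n)`. -/
def pastExpansionRate (ρ : S → ℝ) (f : S → S) : ℝ :=
  ⨆ n : ℕ+, (1 / (n : ℝ)) *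
    ⨅ v : {v : Σ x : S, TangentSpace (𝓡 2) x // ‖v.2‖ = 1}, pastExpansion ρ f n v.1.1 v.1.2

/-- The set `𝒰` of endomorphisms (local diffeomorphisms) `f` of class `C¹` that preserve the volume
`μ = ρ · dA` and satisfy `C(f) > 0`. -/
structure MemU [MeasurableSpace S] (ρ : S → ℝ) (μ : Measure S) (f : S → S) : Prop where
  contMDiff : ContMDiff (𝓡 2) (𝓡 2) 1 f
  isInvertible : ∀ x, (mfderiv (𝓡 2) (𝓡 2) f x).IsInvertible
  measurePreserving : MeasurePreserving f μ μ
  rate_pos : 0 < pastExpansionRate ρ f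

end Surface

section NaturalExtension

/-- The natural extension of `f`, as a set: the full orbits `(x_n)_{n ∈ ℤ}`. Its
sigma-algebra is the one generated by the coordinates. -/
abbrev NaturalExtension {S : Type*} (f : S → S) : Type _ :=
  {x : ℤ → S // ∀ n, f (x (n - 1)) = x n}

variable {S : Type*} {f : S → S}

theorem NaturalExtension.iterate_apply (x : NaturalExtension f) (n : ℕ) :
    f^[n] (x.1 (-n)) = x.1 0 := by
  induction n with
  | zero => simp
  | succ k ih =>
    have h : x.1 (-((k + 1 : ℕ) : ℤ)) = x.1 (-(k : ℤ) - 1) := by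
      rw [Nat.cast_succ, neg_add']
    rw [Function.iterate_succ_apply, h, x.2 (-k), ih]

/-- `μ'` is the lift of `μ` to the natural extension: the (unique) probability measure all of whose
coordinates of index `n ≤ 0` have law `μ`. -/
def IsLift [MeasurableSpace S] (μ : Measure S) (μ' : Measure (NaturalExtension f)) : Prop :=
  IsProbabilityMeasure μ' ∧
    ∀ n : ℤ, n ≤ 0 → ∀ B : Set S, MeasurableSet B → μ' {x | x.1 n ∈ B} = μ B

/-- `κ` is the disintegration `μ' = ∫ κ_x dμ(x)` of `μ'` along the fibres of the projection
`ϑ : (x_n) ↦ x_0`, that is, `κ_x` is a probability measure which for almost every `x` is carried by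
the set `ϑ⁻¹(x)` of pre-orbits of `x`. -/
structure IsDisintegration [MeasurableSpace S] (μ : Measure S) (μ' : Measure (NaturalExtension f))
    (κ : Kernel S (NaturalExtension f)) : Prop where
  isMarkovKernel : IsMarkovKernel κ
  ae_fibre : ∀ᵐ x ∂μ, ∀ᵐ y ∂κ x, y.1 0 = x
  lintegral_eq : ∀ B : Set (NaturalExtension f), MeasurableSet B → μ' B = ∫⁻ x, κ x B ∂μ

end NaturalExtension

section UnstableSpace

variable {S : Type*} [TopologicalSpace S] [ChartedSpace Plane S]
  [RiemannianBundle (fun x : S => TangentSpace (𝓡 2) x)] {f : S → S}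

/-- The vector `df^{(-n)} v = (df^n_{x_{-n}})⁻¹ v`, where `v` is tangent at `x_0`. -/
def backward (x : NaturalExtension f) (n : ℕ) (v : TangentSpace (𝓡 2) (x.1 0)) :
    TangentSpace (𝓡 2) (x.1 (-n)) :=
  pullBack f n (x.iterate_apply n) v

/-- The unstable space `E^u` at a full orbit `x`: the space of the tangent vectors at `x_0` which
are contracted exponentially fast along the past of the orbit. At an Oseledets regular orbit
without zero exponent this is the sum of the Oseledets spaces with positive exponent. -/
def unstableSpace (x : NaturalExtension f) : Submodule ℝ (TangentSpace (𝓡 2) (x.1 0)) where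
  carrier := {v | ∃ C c : ℝ, 0 < c ∧ ∀ n : ℕ, ‖backward x n v‖ ≤ C * Real.exp (-c * n)}
  zero_mem' := ⟨0, 1, one_pos, fun n => by simp [backward, pullBack]⟩
  add_mem' := by
    rintro v w ⟨C, c, hc, hv⟩ ⟨D, d, hd, hw⟩
    refine ⟨|C| + |D|, min c d, lt_min hc hd, fun n => ?_⟩
    have h1 : C * Real.exp (-c * n) ≤ |C| * Real.exp (-(min c d) * n) := by
      gcongr
      · exact le_abs_self C
      · exact min_le_left c d
    have h2 : D * Real.exp (-d * n) ≤ |D| * Real.exp (-(min c d) * n) := by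
      gcongr
      · exact le_abs_self D
      · exact min_le_right c d
    have h3 : backward x n (v + w) = backward x n v + backward x n w := by
      simp [backward, pullBack]
    rw [h3, add_mul]
    exact (norm_add_le _ _).trans (add_le_add ((hv n).trans h1) ((hw n).trans h2))
  smul_mem' := by
    rintro a v ⟨C, c, hc, hv⟩
    refine ⟨|a| * C, c, hc, fun n => ?_⟩
    have h3 : backward x n (a • v) = a • backward x n v := by
      simp [backward, pullBack]
    rw [h3, norm_smul, mul_assoc, Real.norm_eq_abs]
    exact mul_le_mul_of_nonneg_left (hv n) (abs_nonneg a)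

/-- The set of the full orbits `y` with `y_0 = x` whose unstable space is a line making an angle
smaller than `η` with the line `E` of `T_x S`. -/
def unstableNear (f : S → S) (x : S) (E : ℙ ℝ (TangentSpace (𝓡 2) x)) (η : ℝ) :
    Set (NaturalExtension f) :=
  {y | ∃ h : y.1 0 = x, ∃ F : ℙ ℝ (TangentSpace (𝓡 2) x),
    F.submodule = (unstableSpace y).map (tangentCast h).toLinearEquiv.toLinearMap ∧
      lineAngle E F < η}

end UnstableSpace

end UnstableAngle

end

/-! Under `μ_x^-` the coordinate `x_{-n}` sits on the finite fibre of `f^n` over `x` with weights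
`1/|det df^n|` (`ae_law`, by change of variables). So `I(x, v, f^n)` is the mean of `log ‖df^{(-n)}
v‖`, and `C(f) > 0` says that for some `N` this mean is bounded below by a positive constant,
uniformly in `x` and unit `v`. Expanding `a^{-δ} = exp(-δ log a)` to second order makes the mean of
`‖df^{(-N)} v‖^{-δ}` a contraction for small `δ` (`exists_transfer_contraction`), and the Markov
property of the backward orbit gives a mean at most `C r^n ‖v‖^{-δ}` after `n` steps, with `r < 1`
(`exists_moment_bound`).

Summing moments of ratios, almost every pre-orbit expands any fixed vector exponentially, with a
loss at time `n` of only a small exponential factor (`ae_exists_uniform_growth`). Areas, on the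
other hand, stay bounded in the past, because the weights are probabilities. Thus for an orthonormal
basis `b`, with `a_n` the length of the image of `b 0`, the slope of the image of `b 1` over that of
`b 0` changes by at most `D / a_n²` per step. It converges to some `T`, and the unstable space is
the line of `b 1 - T • b 0` (`unstableSpace_eq_span`).

Take `b 0` along `E`. An angle below `η` forces `|T|` to be of order at least `1/η`, hence `∑
a_n^{-2}` is large, and so is `Y = ∑ a_n^{-δ}` (`tsum_inv_sq_le`). Since `Y` has mean at most
`C/(1-r)`, Markov's inequality gives the bound with exponent `δ/2` (`measure_unstableNear_le`). -/

noncomputable section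

namespace UnstableAngle

open Topology

/-! ### Jacobians of linear maps between Euclidean spaces -/

section Jacobian

variable {V W X : Type*} [NormedAddCommGroup V] [InnerProductSpace ℝ V] [FiniteDimensional ℝ V]
    [NormedAddCommGroup W] [InnerProductSpace ℝ W] [FiniteDimensional ℝ W]
    [NormedAddCommGroup X] [InnerProductSpace ℝ X] [FiniteDimensional ℝ X]

theorem det_adjoint_comp_self_nonneg (L : V →ₗ[ℝ] W) :
    0 ≤ LinearMap.det (LinearMap.adjoint L ∘ₗ L) := by
  have h := LinearMap.isPositive_adjoint_comp_self L
  have := (LinearMap.posSemidef_toMatrix_iff (stdOrthonormalBasis ℝ V)).2 h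
  have := this.det_nonneg
  rwa [LinearMap.det_toMatrix] at this

/-- The identity `(ML)*(ML) = (L*L)(L⁻¹ M*M L)` reduces this to multiplicativity of determinants of
endomorphisms and their invariance under conjugation; the latter is why `L` is an equivalence. -/
theorem jacobian_comp (M : W →ₗ[ℝ] X) (L : V ≃ₗ[ℝ] W) :
    jacobian (M ∘ₗ L.toLinearMap) = jacobian M * jacobian L.toLinearMap := by
  have h : LinearMap.adjoint (M ∘ₗ L.toLinearMap) ∘ₗ (M ∘ₗ L.toLinearMap) =
      (LinearMap.adjoint L.toLinearMap ∘ₗ L.toLinearMap) ∘ₗ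
        (L.symm.toLinearMap ∘ₗ (LinearMap.adjoint M ∘ₗ M) ∘ₗ L.symm.symm.toLinearMap) := by
    ext v
    simp [LinearMap.adjoint_comp]
  rw [jacobian, h, LinearMap.det_comp, LinearMap.det_conj, mul_comm,
    Real.sqrt_mul (det_adjoint_comp_self_nonneg M)]
  rfl

theorem jacobian_nonneg (L : V →ₗ[ℝ] W) : 0 ≤ jacobian L := Real.sqrt_nonneg _

theorem jacobian_id : jacobian (LinearMap.id : V →ₗ[ℝ] V) = 1 := by
  simp [jacobian]

theorem jacobian_mul_jacobian_symm (L : V ≃ₗ[ℝ] W) :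
    jacobian L.symm.toLinearMap * jacobian L.toLinearMap = 1 := by
  rw [← jacobian_comp, LinearEquiv.symm_comp, jacobian_id]

theorem jacobian_pos (L : V ≃ₗ[ℝ] W) : 0 < jacobian L.toLinearMap := by
  refine lt_of_le_of_ne (jacobian_nonneg _) fun h => ?_
  simpa [← h] using jacobian_mul_jacobian_symm L

theorem jacobian_eq_abs_det (L : V →ₗ[ℝ] V) : jacobian L = |LinearMap.det L| := by
  have h : LinearMap.det (LinearMap.adjoint L) = LinearMap.det L := by
    let b := stdOrthonormalBasis ℝ V
    rw [← LinearMap.det_toMatrix b.toBasis, ← LinearMap.det_toMatrix b.toBasis L,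
      LinearMap.toMatrix_adjoint, Matrix.det_conjTranspose]
    simp
  rw [jacobian, LinearMap.det_comp, h, Real.sqrt_mul_self_eq_abs]

/-- The matrix of `L*L` in an orthonormal basis is the Gram matrix of the images. Only inner
products remain, which suits both continuity in the base point and area estimates along orbits. -/
theorem jacobian_eq_sqrt_gram (b : OrthonormalBasis (Fin 2) ℝ V) (L : V →ₗ[ℝ] W) :
    jacobian L = Real.sqrt (‖L (b 0)‖ ^ 2 * ‖L (b 1)‖ ^ 2 - inner ℝ (L (b 0)) (L (b 1)) ^ 2) := by
  rw [jacobian, ← LinearMap.det_toMatrix b.toBasis, Matrix.det_fin_two]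
  simp only [LinearMap.toMatrix_apply, OrthonormalBasis.coe_toBasis,
    OrthonormalBasis.coe_toBasis_repr_apply, OrthonormalBasis.repr_apply_apply,
    LinearMap.comp_apply, LinearMap.adjoint_inner_right, real_inner_self_eq_norm_sq]
  rw [real_inner_comm (L (b 0)) (L (b 1)), sq (inner ℝ (L (b 0)) (L (b 1)))]

end Jacobian

/-! ### Slopes of pairs of vectors and angles of lines -/

section Slope

variable {V W : Type*} [NormedAddCommGroup V] [InnerProductSpace ℝ V]
    [NormedAddCommGroup W] [InnerProductSpace ℝ W]

/-- The coefficient of the orthogonal projection of `w` to the line spanned by `v`. -/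
def slope (v w : V) : ℝ := inner ℝ v w / ‖v‖ ^ 2

/-- Height times base: the left side is the area of the parallelogram on `v` and `w`, and the Gram
determinant is its square. -/
theorem norm_sub_slope_mul_norm_le {v : V} (hv : v ≠ 0) (w : V) {K : ℝ} (hK : 0 ≤ K)
    (h : ‖v‖ ^ 2 * ‖w‖ ^ 2 - inner ℝ v w ^ 2 ≤ K ^ 2) : ‖w - slope v w • v‖ * ‖v‖ ≤ K := by
  have h0 : ‖v‖ ≠ 0 := norm_ne_zero_iff.2 hv
  refine abs_le_of_sq_le_sq' ?_ hK |>.2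
  rw [mul_pow, @norm_sub_sq_real, inner_smul_right, norm_smul, mul_pow, Real.norm_eq_abs, sq_abs,
    real_inner_comm v w]
  refine le_trans (le_of_eq ?_) h
  rw [slope]
  field_simp
  ring

/-- Subtracting a multiple of `v` from `w` shifts both slopes equally, so the difference is the
slope over `B v` of the image of the height vector. That vector has length at most `K / ‖v‖`, and
`B` distorts lengths by at most `L`. -/
theorem abs_slope_map_sub_slope_le (B : V →ₗ[ℝ] W) {L K : ℝ} (hK : 0 ≤ K) (hL : 0 ≤ L)
    (hB : ∀ u, ‖B u‖ ≤ L * ‖u‖) (hB' : ∀ u, ‖u‖ ≤ L * ‖B u‖) {v : V} (hv : v ≠ 0) (w : V)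
    (h : ‖v‖ ^ 2 * ‖w‖ ^ 2 - inner ℝ v w ^ 2 ≤ K ^ 2) :
    |slope (B v) (B w) - slope v w| ≤ L ^ 2 * K / ‖v‖ ^ 2 := by
  have h0 : 0 < ‖v‖ := norm_pos_iff.2 hv
  have h1 : 0 < ‖B v‖ := by
    rcases (norm_nonneg (B v)).eq_or_lt with h2 | h2
    · have := hB' v
      rw [← h2, mul_zero] at this
      linarith
    · exact h2
  have h2 : slope (B v) (B w) - slope v w =
      inner ℝ (B v) (B (w - slope v w • v)) / ‖B v‖ ^ 2 := by
    rw [map_sub, map_smul, inner_sub_right, inner_smul_right, real_inner_self_eq_norm_sq,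
      slope, slope]
    field_simp
  have h3 := norm_sub_slope_mul_norm_le hv w hK h
  rw [h2, abs_div, abs_of_pos (pow_pos h1 2), div_le_div_iff₀ (by positivity) (by positivity)]
  calc |inner ℝ (B v) (B (w - slope v w • v))| * ‖v‖ ^ 2
      ≤ (‖B v‖ * (L * ‖w - slope v w • v‖)) * ‖v‖ ^ 2 := by
        gcongr
        exact (abs_real_inner_le_norm _ _).trans (by gcongr; exact hB _)
    _ = ‖B v‖ * L * ‖v‖ * (‖w - slope v w • v‖ * ‖v‖) := by ring
    _ ≤ ‖B v‖ * L * (L * ‖B v‖) * K := by gcongr; exact hB' v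
    _ = _ := by ring

/-- The squared sine of the angle between the lines of `v` and `w - T • v` is `1 / (1 + T²)`, and it
lies below `sin² η ≤ η²`. The bound `η ≤ 1` keeps `cos η` positive, so that cosines may be squared.
-/
theorem one_lt_of_lineAngle_lt {v w : V} (hv : ‖v‖ = 1) (hw : ‖w‖ = 1) (hvw : inner ℝ v w = 0)
    {T η : ℝ} (h0 : 0 < η) (h1 : η ≤ 1) {E F : ℙ ℝ V} (hE : E.submodule = ℝ ∙ v)
    (hF : F.submodule = ℝ ∙ (w - T • v)) (h : lineAngle E F < η) : 1 < η ^ 2 * (1 + T ^ 2) := by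
  have hu : ‖w - T • v‖ ^ 2 = 1 + T ^ 2 := by
    rw [@norm_sub_sq_real, inner_smul_right, norm_smul, mul_pow, Real.norm_eq_abs, sq_abs,
      real_inner_comm v w, hvw, hv, hw]
    ring
  have hvu : inner ℝ v (w - T • v) = -T := by
    rw [inner_sub_right, inner_smul_right, real_inner_self_eq_norm_sq, hvw, hv]
    ring
  obtain ⟨α, hα⟩ := Submodule.mem_span_singleton.1
    (hE ▸ (by rw [E.submodule_eq]; exact Submodule.mem_span_singleton_self _) :
      E.rep ∈ ℝ ∙ v)
  obtain ⟨β, hβ⟩ := Submodule.mem_span_singleton.1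
    (hF ▸ (by rw [F.submodule_eq]; exact Submodule.mem_span_singleton_self _) :
      F.rep ∈ ℝ ∙ (w - T • v))
  have hα0 : 0 < |α| := abs_pos.2 fun h => E.rep_nonzero (by rw [← hα, h, zero_smul])
  have hβ0 : 0 < |β| := abs_pos.2 fun h => F.rep_nonzero (by rw [← hβ, h, zero_smul])
  have hu0 : 0 < ‖w - T • v‖ := by
    refine (norm_nonneg _).lt_of_ne fun h => ?_
    rw [← h] at hu
    nlinarith
  set z := |inner ℝ E.rep F.rep| / (‖E.rep‖ * ‖F.rep‖) with hz
  have hz2 : z ^ 2 * (1 + T ^ 2) = T ^ 2 := by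
    rw [hz, ← hα, ← hβ, inner_smul_left, inner_smul_right, norm_smul, norm_smul, hvu, hv, ← hu]
    simp only [Real.norm_eq_abs, abs_mul, abs_neg, div_pow, mul_pow, sq_abs, conj_trivial]
    have := abs_pos.1 hα0
    have := abs_pos.1 hβ0
    field_simp
  have hz0 : 0 ≤ z := by positivity
  have hz1 : z ≤ 1 :=
    (le_abs_self _).trans (by
      simpa [hz, abs_div] using abs_real_inner_div_norm_mul_norm_le_one E.rep F.rep)
  have hzη : Real.cos η < z := by
    rw [← Real.cos_arccos (by linarith : -1 ≤ z) hz1]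
    exact Real.cos_lt_cos_of_nonneg_of_le_pi (Real.arccos_nonneg _)
      (by linarith [Real.pi_gt_three]) h
  have hc : 0 < Real.cos η := Real.cos_pos_of_mem_Ioo
    ⟨by linarith [Real.pi_gt_three], by linarith [Real.pi_gt_three]⟩
  have hs : Real.sin η ^ 2 ≤ η ^ 2 := by
    have := Real.sin_lt h0
    have := Real.sin_nonneg_of_nonneg_of_le_pi h0.le (by linarith [Real.pi_gt_three])
    gcongr
  have := Real.sin_sq_add_cos_sq η
  have h5 : 1 - z ^ 2 < η ^ 2 := by nlinarith
  nlinarith [sq_nonneg T]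

end Slope

/-! ### Convergence of slopes and comparison of series -/

section Sequences

/-- By `h` the tail `∑_k a_{n+k}^{-2}` is at most a constant times `e^{cn/2} / a_n²`. Multiplied by
`a_n`, and with `1 / a_n` of order at most `e^{-cn}` (the case `n = 0` of `h`), it still decays like
`e^{-cn/2}`: the loss `e^{cn/4}` is small enough to survive squaring. -/
theorem exists_slope_limit {a t : ℕ → ℝ} {D M c : ℝ} (ha : ∀ n, 0 < a n) (hc : 0 < c)
    (hD : 0 ≤ D) (hM : 0 ≤ M) (ht : ∀ n, |t (n + 1) - t n| ≤ D / a n ^ 2)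
    (h : ∀ n k : ℕ, a n ≤ M * Real.exp (c / 4 * n) * Real.exp (-c * k) * a (n + k)) :
    ∃ T : ℝ, (∃ C, ∀ n : ℕ, a n * |T - t n| ≤ C * Real.exp (-(c / 2) * n)) ∧
      Summable (fun n => (a n ^ 2)⁻¹) ∧ |T - t 0| ≤ D * ∑' n, (a n ^ 2)⁻¹ := by
  have hq0 : 0 ≤ Real.exp (-(2 * c)) := (Real.exp_pos _).le
  have hq1 : Real.exp (-(2 * c)) < 1 := Real.exp_lt_one_iff.2 (by linarith)
  have hgeo := summable_geometric_of_lt_one hq0 hq1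
  have hinv : ∀ n k : ℕ, (a (n + k) ^ 2)⁻¹ ≤
      M ^ 2 * Real.exp (c / 4 * n) ^ 2 / a n ^ 2 * Real.exp (-(2 * c)) ^ k := by
    intro n k
    have h1 := ha n
    have h2 := ha (n + k)
    have h3 : Real.exp (-(2 * c)) ^ k = Real.exp (-c * k) ^ 2 := by
      rw [← Real.exp_nat_mul, ← Real.exp_nat_mul]
      congr 1
      push_cast
      ring
    rw [h3, inv_eq_one_div, div_mul_eq_mul_div, div_le_div_iff₀ (by positivity) (by positivity)]
    calc 1 * a n ^ 2 ≤ (M * Real.exp (c / 4 * n) * Real.exp (-c * k) * a (n + k)) ^ 2 := by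
          rw [one_mul]
          gcongr
          exact h n k
      _ = _ := by ring
  have hsum : Summable (fun n => (a n ^ 2)⁻¹) := by
    refine Summable.of_nonneg_of_le (fun n => by positivity) (fun n => ?_)
      (hgeo.mul_left (M ^ 2 * Real.exp (c / 4 * (0 : ℕ)) ^ 2 / a 0 ^ 2))
    simpa using hinv 0 n
  have hsumD : Summable (fun n => D / a n ^ 2) := by
    simpa [div_eq_mul_inv] using hsum.mul_left D
  have hdist : ∀ n, dist (t n) (t n.succ) ≤ D / a n ^ 2 := fun n => by
    rw [dist_comm, Real.dist_eq]
    exact ht n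
  obtain ⟨T, hT⟩ := cauchySeq_tendsto_of_complete (cauchySeq_of_dist_le_of_summable _ hdist hsumD)
  have htail : ∀ n, |T - t n| ≤ D * ∑' k, (a (n + k) ^ 2)⁻¹ := fun n => by
    have := dist_le_tsum_of_dist_le_of_tendsto _ hdist hsumD hT n
    rw [dist_comm, Real.dist_eq] at this
    simpa [div_eq_mul_inv, tsum_mul_left] using this
  refine ⟨T, ⟨D * M ^ 3 / (a 0 * (1 - Real.exp (-(2 * c)))), fun n => ?_⟩, hsum, ?_⟩
  · have h1 := ha n
    have h2 := ha 0
    have h3 : 0 < 1 - Real.exp (-(2 * c)) := by linarith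
    have hle : ∑' k, (a (n + k) ^ 2)⁻¹ ≤
        M ^ 2 * Real.exp (c / 4 * n) ^ 2 / a n ^ 2 * (1 - Real.exp (-(2 * c)))⁻¹ := by
      rw [← tsum_geometric_of_lt_one hq0 hq1, ← tsum_mul_left]
      refine Summable.tsum_le_tsum (hinv n) ?_ (hgeo.mul_left _)
      exact Summable.of_nonneg_of_le (fun k => by positivity) (hinv n) (hgeo.mul_left _)
    have h0n := h 0 n
    simp only [Nat.cast_zero, mul_zero, Real.exp_zero, mul_one, zero_add] at h0n
    calc a n * |T - t n|
        ≤ a n * (D * (M ^ 2 * Real.exp (c / 4 * n) ^ 2 / a n ^ 2 *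
            (1 - Real.exp (-(2 * c)))⁻¹)) := by
          gcongr
          exact (htail n).trans (by gcongr)
      _ = D * M ^ 2 * Real.exp (c / 4 * n) ^ 2 / ((1 - Real.exp (-(2 * c))) * a 0 * a n) * a 0 := by
          field_simp
      _ ≤ D * M ^ 2 * Real.exp (c / 4 * n) ^ 2 / ((1 - Real.exp (-(2 * c))) * a 0 * a n) *
            (M * Real.exp (-c * n) * a n) := by gcongr
      _ = D * M ^ 3 / (a 0 * (1 - Real.exp (-(2 * c)))) *
            (Real.exp (c / 4 * n) ^ 2 * Real.exp (-c * n)) := by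
          field_simp
      _ = _ := by
          rw [← Real.exp_nat_mul, ← Real.exp_add]
          congr 2
          push_cast
          ring
  · simpa using htail 0

/-- Every term `a_n^{-δ}` is at most `Z`, hence `a_n^{-2} = (a_n^{-δ})^{2/δ} ≤ Z^{2/δ-1} a_n^{-δ}`;
`δ ≤ 2` makes the exponent `2/δ - 1` nonnegative. -/
theorem tsum_inv_sq_le {a : ℕ → ℝ} (ha : ∀ n, 0 < a n) {δ Z : ℝ} (hδ : 0 < δ) (hδ2 : δ ≤ 2)
    (hs : Summable (fun n => a n ^ (-δ))) (hZ : ∑' n, a n ^ (-δ) ≤ Z) :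
    ∑' n, (a n ^ 2)⁻¹ ≤ Z ^ (2 / δ) := by
  have hnn : ∀ n, 0 < a n ^ (-δ) := fun n => Real.rpow_pos_of_pos (ha n) _
  have hle : ∀ n, a n ^ (-δ) ≤ Z := fun n =>
    (hs.le_tsum n fun m _ => (hnn m).le).trans hZ
  have hZ0 : 0 < Z := (hnn 0).trans_le (hle 0)
  have key : ∀ n, (a n ^ 2)⁻¹ ≤ Z ^ (2 / δ - 1) * a n ^ (-δ) := fun n => by
    have h1 : (a n ^ 2)⁻¹ = (a n ^ (-δ)) ^ (2 / δ - 1) * a n ^ (-δ) := by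
      rw [← Real.rpow_mul (ha n).le, ← Real.rpow_add (ha n)]
      have : -δ * (2 / δ - 1) + -δ = -2 := by field_simp; ring
      rw [this, Real.rpow_neg (ha n).le]
      norm_cast
    rw [h1]
    refine mul_le_mul_of_nonneg_right ?_ (hnn n).le
    exact Real.rpow_le_rpow (hnn n).le (hle n) (by rw [sub_nonneg, le_div_iff₀ hδ]; linarith)
  have hs2 := hs.mul_left (Z ^ (2 / δ - 1))
  calc ∑' n, (a n ^ 2)⁻¹ ≤ ∑' n, Z ^ (2 / δ - 1) * a n ^ (-δ) :=
        Summable.tsum_le_tsum key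
          (Summable.of_nonneg_of_le (fun n => by have := ha n; positivity) key hs2) hs2
    _ ≤ Z ^ (2 / δ - 1) * Z := by
        rw [tsum_mul_left]
        gcongr
    _ = Z ^ (2 / δ) := by
        rw [← Real.rpow_add_one hZ0.ne']
        congr 1
        ring

end Sequences

/-! ### Chain rules for inverse branches and for the Jacobian with respect to `ρ · dA` -/

section Geometry

variable {S : Type*} [TopologicalSpace S] [ChartedSpace Plane S]

theorem contMDiff_iterate {f : S → S} (hf : ContMDiff (𝓡 2) (𝓡 2) 1 f) (n : ℕ) :
    ContMDiff (𝓡 2) (𝓡 2) 1 f^[n] := by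
  induction n with
  | zero => exact contMDiff_id
  | succ n ih => rw [Function.iterate_succ]; exact ih.comp hf

theorem isInvertible_mfderiv_comp {f g : S → S} (hf : ContMDiff (𝓡 2) (𝓡 2) 1 f)
    (hg : ContMDiff (𝓡 2) (𝓡 2) 1 g) (hf' : ∀ x, (mfderiv (𝓡 2) (𝓡 2) f x).IsInvertible)
    (hg' : ∀ x, (mfderiv (𝓡 2) (𝓡 2) g x).IsInvertible) (x : S) :
    (mfderiv (𝓡 2) (𝓡 2) (g ∘ f) x).IsInvertible := by
  rw [mfderiv_comp x ((hg.mdifferentiable one_ne_zero) _) ((hf.mdifferentiable one_ne_zero) _)]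
  exact (hg' _).comp (hf' x)

theorem isInvertible_mfderiv_iterate {f : S → S} (hf : ContMDiff (𝓡 2) (𝓡 2) 1 f)
    (hf' : ∀ x, (mfderiv (𝓡 2) (𝓡 2) f x).IsInvertible) (n : ℕ) (x : S) :
    (mfderiv (𝓡 2) (𝓡 2) f^[n] x).IsInvertible := by
  induction n generalizing x with
  | zero =>
    rw [Function.iterate_zero, mfderiv_id]
    exact ⟨ContinuousLinearEquiv.refl ℝ _, rfl⟩
  | succ n ih =>
    rw [Function.iterate_succ]
    exact isInvertible_mfderiv_comp hf (contMDiff_iterate hf n) hf' ih x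

variable [RiemannianBundle (fun x : S => TangentSpace (𝓡 2) x)]

theorem pullBack_add {f : S → S} (hf : ContMDiff (𝓡 2) (𝓡 2) 1 f)
    (hf' : ∀ x, (mfderiv (𝓡 2) (𝓡 2) f x).IsInvertible) {m n : ℕ} {x y z : S}
    (h1 : f^[m] z = y) (h2 : f^[n] y = x) (h3 : f^[n + m] z = x) (v : TangentSpace (𝓡 2) x) :
    pullBack f (n + m) h3 v = pullBack f m h1 (pullBack f n h2 v) := by
  subst h1
  -- The tangent space at the image depends on the map itself, so `f^[n + m]` cannot be rewritten in
  -- place; a variable map `F` with an equation is used instead, here and in similar steps below.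
  have key : ∀ F : S → S, F = f^[n] ∘ f^[m] → ∀ h : F z = x,
      (mfderiv (𝓡 2) (𝓡 2) F z).inverse (tangentCast h.symm v) =
      (mfderiv (𝓡 2) (𝓡 2) f^[m] z).inverse (pullBack f n h2 v) := by
    rintro _ rfl h
    subst h2
    rw [mfderiv_comp z (((contMDiff_iterate hf n).mdifferentiable one_ne_zero) _)
      (((contMDiff_iterate hf m).mdifferentiable one_ne_zero) _),
      (isInvertible_mfderiv_iterate hf hf' n _).inverse_comp_of_left]
    rfl
  exact key _ (Function.iterate_add f n m) h3

theorem mfderiv_pullBack {f : S → S} {n : ℕ} {y : S}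
    (hf' : (mfderiv (𝓡 2) (𝓡 2) f^[n] y).IsInvertible)
    (v : TangentSpace (𝓡 2) (f^[n] y)) :
    mfderiv (𝓡 2) (𝓡 2) f^[n] y (pullBack f n rfl v) = v :=
  hf'.self_apply_inverse v

/-- The linear map `(df^n_y)⁻¹`. -/
def pullBackLin (f : S → S) (n : ℕ) {x y : S} (h : f^[n] y = x) :
    TangentSpace (𝓡 2) x →ₗ[ℝ] TangentSpace (𝓡 2) y :=
  (mfderiv (𝓡 2) (𝓡 2) f^[n] y).inverse.toLinearMap ∘ₗ
    (tangentCast h.symm).toLinearEquiv.toLinearMap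

theorem pullBackLin_apply (f : S → S) (n : ℕ) {x y : S} (h : f^[n] y = x)
    (v : TangentSpace (𝓡 2) x) : pullBackLin f n h v = pullBack f n h v := rfl

theorem jacobian_mfderiv_comp {f g : S → S} (hf : ContMDiff (𝓡 2) (𝓡 2) 1 f)
    (hg : ContMDiff (𝓡 2) (𝓡 2) 1 g) {x : S} (hf' : (mfderiv (𝓡 2) (𝓡 2) f x).IsInvertible) :
    jacobian (mfderiv (𝓡 2) (𝓡 2) (g ∘ f) x).toLinearMap =
      jacobian (mfderiv (𝓡 2) (𝓡 2) g (f x)).toLinearMap *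
        jacobian (mfderiv (𝓡 2) (𝓡 2) f x).toLinearMap := by
  rw [mfderiv_comp x ((hg.mdifferentiable one_ne_zero) _) ((hf.mdifferentiable one_ne_zero) _)]
  obtain ⟨e, he⟩ := hf'
  rw [← he]
  exact jacobian_comp (mfderiv (𝓡 2) (𝓡 2) g (f x)).toLinearMap e.toLinearEquiv

theorem jacobian_pos_of_isInvertible {x y : S}
    {A : TangentSpace (𝓡 2) x →L[ℝ] TangentSpace (𝓡 2) y} (h : A.IsInvertible) :
    0 < jacobian A.toLinearMap := by
  obtain ⟨e, rfl⟩ := h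
  exact jacobian_pos e.toLinearEquiv

theorem absDet_pos {ρ : S → ℝ} (hρ : ∀ x, 0 < ρ x) {f : S → S} {y : S}
    (hf' : (mfderiv (𝓡 2) (𝓡 2) f y).IsInvertible) : 0 < absDet ρ f y :=
  mul_pos (div_pos (hρ _) (hρ _)) (jacobian_pos_of_isInvertible hf')

theorem absDet_comp {ρ : S → ℝ} (hρ : ∀ x, 0 < ρ x) {f g : S → S}
    (hf : ContMDiff (𝓡 2) (𝓡 2) 1 f) (hg : ContMDiff (𝓡 2) (𝓡 2) 1 g) {x : S}
    (hf' : (mfderiv (𝓡 2) (𝓡 2) f x).IsInvertible) :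
    absDet ρ (g ∘ f) x = absDet ρ g (f x) * absDet ρ f x := by
  have := (hρ (f x)).ne'
  have := (hρ x).ne'
  rw [absDet, jacobian_mfderiv_comp hf hg hf', absDet, absDet, Function.comp_apply]
  field_simp

theorem absDet_iterate_add {ρ : S → ℝ} (hρ : ∀ x, 0 < ρ x) {f : S → S}
    (hf : ContMDiff (𝓡 2) (𝓡 2) 1 f) (hf' : ∀ x, (mfderiv (𝓡 2) (𝓡 2) f x).IsInvertible)
    (n m : ℕ) (z : S) :
    absDet ρ f^[n + m] z = absDet ρ f^[n] (f^[m] z) * absDet ρ f^[m] z := by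
  rw [Function.iterate_add]
  exact absDet_comp hρ (contMDiff_iterate hf m) (contMDiff_iterate hf n)
    (isInvertible_mfderiv_iterate hf hf' m z)

/-- The Gram determinant is the squared Riemannian Jacobian of `(df^n_y)⁻¹`; the factor `ρ x / ρ y`
passes from the Riemannian area to `μ`. -/
theorem gram_pullBack {ρ : S → ℝ} (hρ : ∀ x, 0 < ρ x) {f : S → S} {n : ℕ} {x y : S}
    (hf' : (mfderiv (𝓡 2) (𝓡 2) f^[n] y).IsInvertible) (h : f^[n] y = x)
    (b : OrthonormalBasis (Fin 2) ℝ (TangentSpace (𝓡 2) x)) :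
    ‖pullBack f n h (b 0)‖ ^ 2 * ‖pullBack f n h (b 1)‖ ^ 2 -
      inner ℝ (pullBack f n h (b 0)) (pullBack f n h (b 1)) ^ 2 ≤
        (ρ x / ρ y / absDet ρ f^[n] y) ^ 2 := by
  subst h
  have h1 := jacobian_eq_sqrt_gram b (pullBackLin f n rfl)
  simp only [pullBackLin_apply] at h1
  have h2 : jacobian (pullBackLin f n (rfl : f^[n] y = f^[n] y)) *
      jacobian (mfderiv (𝓡 2) (𝓡 2) f^[n] y).toLinearMap = 1 := by
    obtain ⟨e, he⟩ := hf'
    have h3 : pullBackLin f n (rfl : f^[n] y = f^[n] y) = e.toLinearEquiv.symm.toLinearMap := by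
      ext v
      change (mfderiv (𝓡 2) (𝓡 2) f^[n] y).inverse v = _
      rw [← he, ContinuousLinearMap.inverse_equiv]
      rfl
    rw [h3, ← he]
    exact jacobian_mul_jacobian_symm e.toLinearEquiv
  have h4 : jacobian (pullBackLin f n (rfl : f^[n] y = f^[n] y)) =
      ρ (f^[n] y) / ρ y / absDet ρ f^[n] y := by
    have := (hρ (f^[n] y)).ne'
    have := (hρ y).ne'
    have := (jacobian_pos_of_isInvertible hf').ne'
    rw [eq_div_of_mul_eq this h2, absDet]
    field_simp
  rw [← h4, h1]
  rcases le_total 0 (‖pullBack f n rfl (b 0)‖ ^ 2 * ‖pullBack f n rfl (b 1)‖ ^ 2 -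
      inner ℝ (pullBack f n rfl (b 0)) (pullBack f n rfl (b 1)) ^ 2) with h5 | h5
  · rw [Real.sq_sqrt h5]
  · exact h5.trans (sq_nonneg _)

end Geometry

/-! ### Continuity of the metric along `C¹` maps and uniform distortion bounds -/

section Continuity

variable {S : Type*} [TopologicalSpace S] [ChartedSpace Plane S] [IsManifold (𝓡 2) ∞ S]

theorem exists_smul_unit (ξ : Plane) : ∃ (r : ℝ) (e : Plane), 0 ≤ r ∧ ‖e‖ = 1 ∧ ξ = r • e := by
  by_cases hξ : ξ = 0
  · exact ⟨0, EuclideanSpace.basisFun (Fin 2) ℝ 0, le_rfl, by simp, by simp [hξ]⟩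
  have : ‖ξ‖ ≠ 0 := norm_ne_zero_iff.2 hξ
  refine ⟨‖ξ‖, ‖ξ‖⁻¹ • ξ, by positivity, ?_, ?_⟩
  · rw [norm_smul, norm_inv, norm_norm, inv_mul_cancel₀ this]
  · rw [smul_smul, mul_inv_cancel₀ this, one_smul]

theorem mfderiv_comp_chart_symm {f : S → S} (hf : ContMDiff (𝓡 2) (𝓡 2) 1 f) (p : S) {z : Plane}
    (hz : z ∈ (chartAt Plane p).target) :
    mfderiv (𝓡 2) (𝓡 2) (f ∘ (chartAt Plane p).symm) z =
      (mfderiv (𝓡 2) (𝓡 2) f ((chartAt Plane p).symm z)).comp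
        (mfderiv (𝓡 2) (𝓡 2) (chartAt Plane p).symm z) :=
  mfderiv_comp z ((hf.mdifferentiable one_ne_zero) _)
    (mdifferentiableAt_atlas_symm (chart_mem_atlas _ p) hz)

theorem contMDiffOn_chart_symm_one (p : S) :
    ContMDiffOn (𝓡 2) (𝓡 2) 1 (chartAt Plane p).symm (chartAt Plane p).target :=
  (contMDiffOn_chart_symm (n := ∞)).of_le (by exact_mod_cast le_top)

theorem isInvertible_mfderiv_chart_symm (p : S) {z : Plane}
    (hz : z ∈ (chartAt Plane p).target) :
    (mfderiv (𝓡 2) (𝓡 2) (chartAt Plane p).symm z).IsInvertible := by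
  have h := mdifferentiable_chart (I := 𝓡 2) p
  exact ⟨h.symm.mfderiv hz, rfl⟩

variable [RiemannianBundle (fun x : S => TangentSpace (𝓡 2) x)]
  [IsContMDiffRiemannianBundle (𝓡 2) ∞ Plane (fun x : S => TangentSpace (𝓡 2) x)]

theorem continuousOn_inner_mfderiv {h : Plane → S} {O : Set Plane} (hO : IsOpen O)
    (hh : ContMDiffOn (𝓡 2) (𝓡 2) 1 h O) :
    ContinuousOn (fun q : Plane × Plane × Plane =>
      (inner ℝ (mfderiv (𝓡 2) (𝓡 2) h q.1 q.2.1 : TangentSpace (𝓡 2) (h q.1))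
        (mfderiv (𝓡 2) (𝓡 2) h q.1 q.2.2 : TangentSpace (𝓡 2) (h q.1)) : ℝ)) (O ×ˢ Set.univ) := by
  have : IsManifold (𝓡 2) 1 S := IsManifold.of_le (n := ∞) (by exact_mod_cast le_top)
  have : IsContinuousRiemannianBundle Plane (fun x : S => TangentSpace (𝓡 2) x) := by
    obtain ⟨g, hg, hg'⟩ := IsContMDiffRiemannianBundle.exists_contMDiff (IB := 𝓡 2) (n := ∞)
      (F := Plane) (E := fun x : S => TangentSpace (𝓡 2) x)
    exact ⟨g, hg.continuous, hg'⟩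
  have hT := hh.continuousOn_tangentMapWithin le_rfl hO.uniqueMDiffOn
  have hT' : ∀ g : Plane × Plane × Plane → Plane, Continuous g →
      ContinuousOn (fun q : Plane × Plane × Plane =>
        (⟨h q.1, mfderiv (𝓡 2) (𝓡 2) h q.1 (g q)⟩ : TangentBundle (𝓡 2) S)) (O ×ˢ Set.univ) := by
    intro g hg
    have hc : Continuous (fun q : Plane × Plane × Plane =>
        (⟨q.1, g q⟩ : TangentBundle (𝓡 2) Plane)) :=
      (tangentBundleModelSpaceHomeomorph (𝓡 2)).symm.continuous.comp
        (continuous_fst.prodMk hg : Continuous fun q : Plane × Plane × Plane => (q.1, g q))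
    refine (hT.comp hc.continuousOn fun q hq => hq.1).congr fun q hq => ?_
    simp only [Function.comp_apply, tangentMapWithin,
      mfderivWithin_of_mem_nhds (hO.mem_nhds hq.1)]
  exact (hT' _ (continuous_fst.comp continuous_snd)).inner_bundle
    (hT' _ (continuous_snd.comp continuous_snd))

theorem continuousOn_jacobian_mfderiv {h : Plane → S} {O : Set Plane} (hO : IsOpen O)
    (hh : ContMDiffOn (𝓡 2) (𝓡 2) 1 h O) :
    ContinuousOn (fun z => jacobian (V := Plane) (W := TangentSpace (𝓡 2) (h z))
      (mfderiv (𝓡 2) (𝓡 2) h z : Plane →L[ℝ] _).toLinearMap) O := by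
  have hc := continuousOn_inner_mfderiv hO hh
  have hi : ∀ i j : Fin 2, ContinuousOn (fun z : Plane =>
      (inner ℝ (mfderiv (𝓡 2) (𝓡 2) h z (EuclideanSpace.basisFun (Fin 2) ℝ i) :
          TangentSpace (𝓡 2) (h z))
        (mfderiv (𝓡 2) (𝓡 2) h z (EuclideanSpace.basisFun (Fin 2) ℝ j) :
          TangentSpace (𝓡 2) (h z)) : ℝ)) O := fun i j =>
    hc.comp (f := fun z : Plane => (z, EuclideanSpace.basisFun (Fin 2) ℝ i,
      EuclideanSpace.basisFun (Fin 2) ℝ j)) (by fun_prop) fun z hz => ⟨hz, trivial⟩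
  refine (((hi 0 0).mul (hi 1 1)).sub ((hi 0 1).pow 2)).sqrt.congr fun z hz => ?_
  have h1 := jacobian_eq_sqrt_gram (W := TangentSpace (𝓡 2) (h z)) (EuclideanSpace.basisFun (Fin 2) ℝ)
    (mfderiv (𝓡 2) (𝓡 2) h z : Plane →L[ℝ] _).toLinearMap
  rw [← real_inner_self_eq_norm_sq, ← real_inner_self_eq_norm_sq] at h1
  exact h1

/-- In a chart both norms are continuous and nonvanishing on a compact set of base points times the
unit circle, so their ratios are bounded; homogeneity and a finite subcover do the rest. -/
theorem exists_norm_bounds [CompactSpace S] {f : S → S} (hf : ContMDiff (𝓡 2) (𝓡 2) 1 f)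
    (hf' : ∀ x, (mfderiv (𝓡 2) (𝓡 2) f x).IsInvertible) :
    ∃ L : ℝ, 1 ≤ L ∧ ∀ (y : S) (u : TangentSpace (𝓡 2) y),
      ‖mfderiv (𝓡 2) (𝓡 2) f y u‖ ≤ L * ‖u‖ ∧ ‖u‖ ≤ L * ‖mfderiv (𝓡 2) (𝓡 2) f y u‖ := by
  have hloc : ∀ p : S, ∃ U ∈ 𝓝 p, ∃ L : ℝ, ∀ y ∈ U, ∀ u : TangentSpace (𝓡 2) y,
      ‖mfderiv (𝓡 2) (𝓡 2) f y u‖ ≤ L * ‖u‖ ∧ ‖u‖ ≤ L * ‖mfderiv (𝓡 2) (𝓡 2) f y u‖ := by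
    intro p
    set φ := chartAt Plane p
    obtain ⟨K, hK, hKφ, hKc⟩ := local_compact_nhds
      (φ.open_target.mem_nhds (φ.map_source (mem_chart_source Plane p)))
    have c1 := continuousOn_inner_mfderiv φ.open_target (contMDiffOn_chart_symm_one p)
    have c2 := continuousOn_inner_mfderiv φ.open_target
      (hf.comp_contMDiffOn (contMDiffOn_chart_symm_one p))
    set C : Set (Plane × Plane) := K ×ˢ Metric.sphere 0 1
    have hC : IsCompact C := hKc.prod (isCompact_sphere _ _)
    have hn : ∀ (g : Plane → S), ContinuousOn (fun q : Plane × Plane × Plane =>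
      (inner ℝ (mfderiv (𝓡 2) (𝓡 2) g q.1 q.2.1 : TangentSpace (𝓡 2) (g q.1))
        (mfderiv (𝓡 2) (𝓡 2) g q.1 q.2.2 : TangentSpace (𝓡 2) (g q.1)) : ℝ))
        (φ.target ×ˢ Set.univ) → ContinuousOn (fun q : Plane × Plane =>
          ‖(mfderiv (𝓡 2) (𝓡 2) g q.1 q.2 : TangentSpace (𝓡 2) (g q.1))‖) C := by
      intro g hg
      have := (hg.comp (f := fun q : Plane × Plane => (q.1, q.2, q.2)) (s := C) (by fun_prop)
        fun q hq => ⟨hKφ hq.1, trivial⟩).sqrt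
      refine this.congr fun q hq => ?_
      exact norm_eq_sqrt_real_inner _
    have n1 := hn _ c1
    have n2 := hn _ c2
    have hinj : ∀ q ∈ C, (mfderiv (𝓡 2) (𝓡 2) φ.symm q.1 q.2 :
        TangentSpace (𝓡 2) (φ.symm q.1)) ≠ 0 := by
      intro q hq h0
      have := (isInvertible_mfderiv_chart_symm p (hKφ hq.1)).injective (h0.trans (map_zero _).symm)
      have h1 := hq.2
      rw [mem_sphere_zero_iff_norm, this] at h1
      exact one_ne_zero (h1.symm.trans (norm_zero (E := Plane)))
    have hcomp : ∀ z ∈ K, ∀ ξ : Plane, (mfderiv (𝓡 2) (𝓡 2) (f ∘ φ.symm) z ξ :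
        TangentSpace (𝓡 2) (f (φ.symm z))) = mfderiv (𝓡 2) (𝓡 2) f (φ.symm z)
          (mfderiv (𝓡 2) (𝓡 2) φ.symm z ξ) := by
      intro z hz ξ
      rw [mfderiv_comp_chart_symm hf p (hKφ hz)]
      rfl
    have m1 : ∀ q ∈ C, ‖(mfderiv (𝓡 2) (𝓡 2) φ.symm q.1 q.2 :
        TangentSpace (𝓡 2) (φ.symm q.1))‖ ≠ 0 := fun q hq => norm_ne_zero_iff.2 (hinj q hq)
    have m2 : ∀ q ∈ C, ‖(mfderiv (𝓡 2) (𝓡 2) (f ∘ φ.symm) q.1 q.2 :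
        TangentSpace (𝓡 2) ((f ∘ φ.symm) q.1))‖ ≠ 0 := fun q hq => by
      refine norm_ne_zero_iff.2 fun h0 => hinj q hq ?_
      erw [hcomp q.1 hq.1 q.2] at h0
      exact (hf' _).injective (h0.trans (map_zero _).symm)
    obtain ⟨L1, hL1⟩ := hC.exists_bound_of_continuousOn (n1.div n2 m2)
    obtain ⟨L2, hL2⟩ := hC.exists_bound_of_continuousOn (n2.div n1 m1)
    refine ⟨φ.source ∩ φ ⁻¹' K, Filter.inter_mem (φ.open_source.mem_nhds (mem_chart_source _ p))
      ((φ.continuousAt (mem_chart_source _ p)).preimage_mem_nhds hK), max L1 L2, ?_⟩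
    rintro y ⟨hy, hyK⟩ u
    obtain ⟨z, hz, rfl⟩ : ∃ z ∈ K, φ.symm z = y := ⟨φ y, hyK, φ.left_inv hy⟩
    obtain ⟨(ξ : Plane), rfl⟩ := (isInvertible_mfderiv_chart_symm p (hKφ hz)).surjective u
    obtain ⟨r, e, hr, he, rfl⟩ := exists_smul_unit ξ
    have hq : (z, e) ∈ C := ⟨hz, mem_sphere_zero_iff_norm.2 he⟩
    have b1 := (Real.norm_eq_abs _ ▸ (le_abs_self _)).trans (hL1 _ hq)
    have b2 := (Real.norm_eq_abs _ ▸ (le_abs_self _)).trans (hL2 _ hq)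
    have p1 := (norm_nonneg _).lt_of_ne (m1 _ hq).symm
    have p2 := (norm_nonneg _).lt_of_ne (m2 _ hq).symm
    simp only [Pi.div_apply] at b1 b2
    rw [div_le_iff₀ p2] at b1
    rw [div_le_iff₀ p1] at b2
    erw [hcomp z hz e] at b1 b2 p2
    erw [map_smul, map_smul, norm_smul, norm_smul]
    rw [Real.norm_eq_abs, abs_of_nonneg hr, mul_left_comm, mul_left_comm _ r]
    constructor
    · refine mul_le_mul_of_nonneg_left (b2.trans ?_) hr
      exact mul_le_mul_of_nonneg_right (le_max_right _ _) p1.le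
    · refine mul_le_mul_of_nonneg_left (b1.trans ?_) hr
      exact mul_le_mul_of_nonneg_right (le_max_left _ _) p2.le
  choose U hU L hL using hloc
  obtain ⟨t, ht⟩ := CompactSpace.elim_nhds_subcover U hU
  -- This sum dominates every local constant and is at least `1` even for an empty cover.
  refine ⟨1 + ∑ p ∈ t, |L p|, by simpa using Finset.sum_nonneg fun p _ => abs_nonneg (L p),
    fun y u => ?_⟩
  obtain ⟨p, hp, hy⟩ : ∃ p ∈ t, y ∈ U p := by
    simpa using ht.ge (Set.mem_univ y)
  have hle : L p ≤ 1 + ∑ p ∈ t, |L p| := by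
    have := Finset.single_le_sum (f := fun p => |L p|) (fun p _ => abs_nonneg (L p)) hp
    linarith [le_abs_self (L p)]
  exact ⟨(hL p y hy u).1.trans (mul_le_mul_of_nonneg_right hle (norm_nonneg _)),
    (hL p y hy u).2.trans (mul_le_mul_of_nonneg_right hle (norm_nonneg _))⟩

end Continuity

/-! ### Change of variables on the surface -/

section ChangeOfVariables

theorem polishSpace_of_chartedSpace {S : Type*} [TopologicalSpace S] [ChartedSpace Plane S]
    [T2Space S] [CompactSpace S] : PolishSpace S := by
  have := ChartedSpace.secondCountable_of_sigmaCompact Plane S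
  let _ := TopologicalSpace.metrizableSpaceMetric S
  infer_instance

variable {S : Type*} [TopologicalSpace S] [ChartedSpace Plane S]
  [RiemannianBundle (fun x : S => TangentSpace (𝓡 2) x)]

/-- The Jacobian of a map from the plane to a surface. -/
def planeJacobian (h : Plane → S) (z : Plane) : ℝ :=
  jacobian (V := Plane) (W := TangentSpace (𝓡 2) (h z))
    (mfderiv (𝓡 2) (𝓡 2) h z : Plane →L[ℝ] _).toLinearMap

/-- The two derivatives land in tangent spaces at points that are only propositionally equal, hence
the detour through arbitrary `a` and `b`. -/
theorem planeJacobian_congr {h h' : Plane → S} {z : Plane} (hh : h =ᶠ[𝓝 z] h') :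
    planeJacobian h z = planeJacobian h' z := by
  have key : ∀ (a b : S), a = b → ∀ (A : Plane →L[ℝ] TangentSpace (𝓡 2) a)
      (B : Plane →L[ℝ] TangentSpace (𝓡 2) b), (A : Plane →L[ℝ] Plane) = B →
      jacobian (V := Plane) A.toLinearMap = jacobian (V := Plane) B.toLinearMap := by
    rintro a _ rfl A B hAB
    have : A = B := hAB
    rw [this]
  exact key _ _ hh.eq_of_nhds _ _ hh.mfderiv_eq

theorem planeJacobian_comp_of_injective {h : Plane → S} {G : Plane → Plane} {z : Plane}
    (hh : MDifferentiableAt (𝓡 2) (𝓡 2) h (G z)) (hG : DifferentiableAt ℝ G z)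
    (hinj : Function.Injective (mfderiv (𝓡 2) (𝓡 2) (h ∘ G) z)) :
    planeJacobian (h ∘ G) z = planeJacobian h (G z) * |(fderiv ℝ G z).det| := by
  have h1 : mfderiv (𝓡 2) (𝓡 2) (h ∘ G) z = (mfderiv (𝓡 2) (𝓡 2) h (G z)).comp (fderiv ℝ G z) := by
    rw [mfderiv_comp z hh hG.mdifferentiableAt, mfderiv_eq_fderiv]
    rfl
  have h2 : Function.Injective (fderiv ℝ G z).toLinearMap := by
    intro a b hab
    apply hinj
    rw [h1]
    exact congrArg (mfderiv (𝓡 2) (𝓡 2) h (G z)) hab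
  have h3 := jacobian_comp (V := Plane) (W := Plane) (X := TangentSpace (𝓡 2) (h (G z)))
    (mfderiv (𝓡 2) (𝓡 2) h (G z) : Plane →L[ℝ] _).toLinearMap
    (LinearEquiv.ofInjectiveEndo _ h2)
  have h4 : (LinearEquiv.ofInjectiveEndo _ h2).toLinearMap = (fderiv ℝ G z).toLinearMap := by
    ext v : 1
    simp
  rw [h4, jacobian_eq_abs_det (V := Plane)] at h3
  rw [planeJacobian, h1]
  exact h3

variable [IsManifold (𝓡 2) ∞ S]

theorem planeJacobian_comp_chart_symm {f : S → S} (hf : ContMDiff (𝓡 2) (𝓡 2) 1 f) (p : S)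
    {z : Plane} (hz : z ∈ (chartAt Plane p).target) :
    planeJacobian (f ∘ (chartAt Plane p).symm) z =
      jacobian (mfderiv (𝓡 2) (𝓡 2) f ((chartAt Plane p).symm z)).toLinearMap *
        planeJacobian (chartAt Plane p).symm z := by
  obtain ⟨e, he⟩ := isInvertible_mfderiv_chart_symm p hz
  have h1 := jacobian_comp (V := Plane) (W := TangentSpace (𝓡 2) ((chartAt Plane p).symm z))
    (X := TangentSpace (𝓡 2) (f ((chartAt Plane p).symm z)))
    (mfderiv (𝓡 2) (𝓡 2) f ((chartAt Plane p).symm z)).toLinearMap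
    (e : Plane ≃L[ℝ] TangentSpace (𝓡 2) ((chartAt Plane p).symm z)).toLinearEquiv
  have h2 := mfderiv_comp_chart_symm hf p hz
  rw [← he] at h2
  rw [planeJacobian, planeJacobian, h2, ← he]
  exact h1

theorem planeJacobian_chart_symm_pos (p : S) {z : Plane}
    (hz : z ∈ (chartAt Plane p).target) : 0 < planeJacobian (chartAt Plane p).symm z := by
  obtain ⟨e, he⟩ := isInvertible_mfderiv_chart_symm p hz
  rw [planeJacobian, ← he]
  exact jacobian_pos (V := Plane)
    (e : Plane ≃L[ℝ] TangentSpace (𝓡 2) ((chartAt Plane p).symm z)).toLinearEquiv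

variable [IsContMDiffRiemannianBundle (𝓡 2) ∞ Plane (fun x : S => TangentSpace (𝓡 2) x)]

theorem continuousOn_planeJacobian {h : Plane → S} {O : Set Plane} (hO : IsOpen O)
    (hh : ContMDiffOn (𝓡 2) (𝓡 2) 1 h O) : ContinuousOn (planeJacobian h) O :=
  continuousOn_jacobian_mfderiv hO hh

/-- In a chart `φ` the Jacobian of `f` is the quotient of those of `f ∘ φ⁻¹` and `φ⁻¹`, both
continuous by the Gram formula. -/
theorem continuous_absDet {ρ : S → ℝ} (hρc : Continuous ρ) (hρ : ∀ x, 0 < ρ x) {f : S → S}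
    (hf : ContMDiff (𝓡 2) (𝓡 2) 1 f) : Continuous (absDet ρ f) := by
  refine (hρc.comp hf.continuous).div hρc (fun x => (hρ x).ne') |>.mul ?_
  refine continuous_iff_continuousAt.2 fun p => ?_
  set φ := chartAt Plane p
  have hp := mem_chart_source Plane p
  have c1 := (continuousOn_planeJacobian φ.open_target (contMDiffOn_chart_symm_one p)).continuousAt
    (φ.open_target.mem_nhds (φ.map_source hp))
  have c2 := (continuousOn_planeJacobian φ.open_target
    (hf.comp_contMDiffOn (contMDiffOn_chart_symm_one p))).continuousAt
    (φ.open_target.mem_nhds (φ.map_source hp))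
  have c3 := (c2.div c1 (planeJacobian_chart_symm_pos p (φ.map_source hp)).ne').comp
    (φ.continuousAt hp)
  refine c3.congr ?_
  filter_upwards [φ.open_source.mem_nhds hp] with y hy
  have h1 := planeJacobian_comp_chart_symm hf p (φ.map_source hy)
  rw [Function.comp_apply, Pi.div_apply, h1,
    mul_div_cancel_right₀ _ (planeJacobian_chart_symm_pos p (φ.map_source hy)).ne', φ.left_inv hy]

variable [MeasurableSpace S] {μ : Measure S} {ρ : S → ℝ}

theorem aemeasurable_chart_density (hμ : IsSmoothVolume ρ μ) (p : S) :
    AEMeasurable (fun z => ENNReal.ofReal (ρ ((chartAt Plane p).symm z) *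
      planeJacobian (chartAt Plane p).symm z)) (volume.restrict (chartAt Plane p).target) := by
  refine (ContinuousOn.aemeasurable ?_ (chartAt Plane p).open_target.measurableSet).ennreal_ofReal
  exact (hμ.contMDiff.continuous.comp_continuousOn (chartAt Plane p).continuousOn_symm).mul
    (continuousOn_planeJacobian (chartAt Plane p).open_target (contMDiffOn_chart_symm_one p))

variable [BorelSpace S]

/-- The defining formula for sets says that `μ` on the chart domain is the image under `φ⁻¹` of a
measure with density; integrals follow. -/
theorem setLIntegral_eq_chart (hμ : IsSmoothVolume ρ μ) (p : S) {B : Set S} (hB : MeasurableSet B)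
    (hBp : B ⊆ (chartAt Plane p).source) {h : S → ENNReal} (hh : Measurable h) :
    ∫⁻ y in B, h y ∂μ = ∫⁻ z in chartAt Plane p '' B, h ((chartAt Plane p).symm z) *
      ENNReal.ofReal (ρ ((chartAt Plane p).symm z) * planeJacobian (chartAt Plane p).symm z) := by
  classical
  have hJ := aemeasurable_chart_density hμ p
  have hm := hμ.measure_eq p
  set φ := chartAt Plane p
  set J := fun z => ENNReal.ofReal (ρ (φ.symm z) * planeJacobian φ.symm z)
  have hφs : AEMeasurable φ.symm (volume.restrict φ.target) :=
    φ.continuousOn_symm.aemeasurable φ.open_target.measurableSet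
  have hφs' : AEMeasurable φ.symm ((volume.restrict φ.target).withDensity J) :=
    hφs.mono_ac (withDensity_absolutelyContinuous _ _)
  have him : ∀ A : Set S, φ.symm ⁻¹' A ∩ φ.target = φ '' (A ∩ φ.source) := fun A => by
    rw [φ.image_eq_target_inter_inv_preimage Set.inter_subset_right]
    ext z
    simp only [Set.mem_inter_iff, Set.mem_preimage]
    exact ⟨fun h => ⟨h.2, h.1, φ.map_target h.2⟩, fun h => ⟨h.2.1, h.1⟩⟩
  have hres : μ.restrict φ.source = ((volume.restrict φ.target).withDensity J).map φ.symm := by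
    ext A hA
    rw [Measure.map_apply_of_aemeasurable hφs' hA, withDensity_apply',
      Measure.restrict_restrict' φ.open_target.measurableSet, him, Measure.restrict_apply hA]
    exact hm (A ∩ φ.source) (hA.inter φ.open_source.measurableSet) Set.inter_subset_right
  have hg : Measurable (B.indicator h) := hh.indicator hB
  calc ∫⁻ y in B, h y ∂μ = ∫⁻ y in φ.source, B.indicator h y ∂μ := by
        rw [lintegral_indicator hB, Measure.restrict_restrict hB, Set.inter_eq_left.2 hBp]
    _ = ∫⁻ z in φ.target, (J * fun z => B.indicator h (φ.symm z)) z := by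
        rw [hres, lintegral_map' hg.aemeasurable hφs']
        exact lintegral_withDensity_eq_lintegral_mul₀' hJ (hg.comp_aemeasurable hφs')
    _ = ∫⁻ z in φ.target, (φ.target ∩ φ.symm ⁻¹' B).indicator (fun z => h (φ.symm z) * J z) z := by
        refine setLIntegral_congr_fun φ.open_target.measurableSet fun z hz => ?_
        simp only [Pi.mul_apply, Set.indicator]
        by_cases hzB : φ.symm z ∈ B
        · simp [hzB, hz, mul_comm]
        · simp [hzB]
    _ = _ := by
        have hmeas : MeasurableSet (φ.target ∩ φ.symm ⁻¹' B) := by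
          -- The inverse chart is controlled only on its target, so it is extended by a constant to
          -- a measurable map.
          have := φ.continuousOn_symm.measurable_piecewise (g := fun _ => p)
            continuous_const.continuousOn φ.open_target.measurableSet
          have h2 := φ.open_target.measurableSet.inter (this hB)
          convert h2 using 1
          ext z
          simp only [Set.mem_inter_iff, Set.mem_preimage]
          refine and_congr_right fun hz => ?_
          rw [Set.piecewise_eq_of_mem _ _ _ hz]
        rw [lintegral_indicator hmeas, Measure.restrict_restrict hmeas,
          Set.inter_eq_left.2 Set.inter_subset_left, Set.inter_comm, him B,
          Set.inter_eq_left.2 hBp]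

variable [T2Space S] [CompactSpace S]

/-- The change of variables formula for a local diffeomorphism of a surface. -/
theorem measure_image_eq_setLIntegral_absDet (hμ : IsSmoothVolume ρ μ) {g : S → S}
    (hg : ContMDiff (𝓡 2) (𝓡 2) 1 g) (hg' : ∀ x, (mfderiv (𝓡 2) (𝓡 2) g x).IsInvertible)
    {p q : S} {B : Set S} (hB : MeasurableSet B) (hinj : Set.InjOn g B)
    (hBp : B ⊆ (chartAt Plane p).source) (hBq : g '' B ⊆ (chartAt Plane q).source) :
    MeasurableSet (g '' B) ∧ μ (g '' B) = ∫⁻ y in B, ENNReal.ofReal (absDet ρ g y) ∂μ := by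
  have : PolishSpace S := polishSpace_of_chartedSpace
  have hgB : MeasurableSet (g '' B) :=
    hB.image_of_continuousOn_injOn hg.continuous.continuousOn hinj
  refine ⟨hgB, ?_⟩
  rw [setLIntegral_eq_chart hμ p hB hBp
    (continuous_absDet hμ.contMDiff.continuous hμ.pos hg).measurable.ennreal_ofReal]
  have hm := hμ.measure_eq q (g '' B) hgB hBq
  set φ := chartAt Plane p with hφ
  set ψ := chartAt Plane q with hψ
  set G : Plane → Plane := ψ ∘ g ∘ φ.symm with hG
  have him : ψ '' (g '' B) = G '' (φ '' B) := by
    rw [Set.image_image, Set.image_image]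
    refine Set.image_congr fun y hy => ?_
    rw [hG, Function.comp_apply, Function.comp_apply, φ.left_inv (hBp hy)]
  have hφB : MeasurableSet (φ '' B) :=
    hB.image_of_continuousOn_injOn (φ.continuousOn.mono hBp) (φ.injOn.mono hBp)
  have hGd : ∀ y ∈ B, DifferentiableAt ℝ G (φ y) := fun y hy => by
    have h1 : MDifferentiableAt (𝓡 2) (𝓡 2) (g ∘ φ.symm) (φ y) :=
      ((hg.mdifferentiable one_ne_zero) _).comp _
        (mdifferentiableAt_atlas_symm (chart_mem_atlas _ p) (φ.map_source (hBp hy)))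
    have h2 : (g ∘ φ.symm) (φ y) ∈ ψ.source := by
      rw [Function.comp_apply, φ.left_inv (hBp hy)]
      exact hBq ⟨y, hy, rfl⟩
    exact mdifferentiableAt_iff_differentiableAt.1
      ((mdifferentiableAt_atlas (chart_mem_atlas _ q) h2).comp _ h1)
  have hGinj : Set.InjOn G (φ '' B) := by
    rintro _ ⟨y, hy, rfl⟩ _ ⟨y', hy', rfl⟩ h
    simp only [hG, Function.comp_apply, φ.left_inv (hBp hy), φ.left_inv (hBp hy')] at h
    rw [hinj hy hy' (ψ.injOn (hBq ⟨y, hy, rfl⟩) (hBq ⟨y', hy', rfl⟩) h)]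
  have hcv := lintegral_image_eq_lintegral_abs_det_fderiv_mul volume hφB
    (f' := fun z => fderiv ℝ G z) (f := G) (by
      rintro _ ⟨y, hy, rfl⟩
      exact (hGd y hy).hasFDerivAt.hasFDerivWithinAt) hGinj
    (fun z => ENNReal.ofReal (ρ (ψ.symm z) * planeJacobian ψ.symm z))
  rw [← him] at hcv
  refine hm.trans (hcv.trans (setLIntegral_congr_fun hφB ?_))
  rintro _ ⟨y, hy, rfl⟩
  have hys := hBp hy
  have hz := φ.map_source hys
  -- The Jacobian of this common map, computed in two ways, gives `J(ψ⁻¹) |det DG| = J(dg) J(φ⁻¹)`,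
  -- which matches the two integrands up to the densities `ρ`.
  have hev : ψ.symm ∘ G =ᶠ[𝓝 (φ y)] g ∘ φ.symm := by
    have hc : ContinuousAt (g ∘ φ.symm) (φ y) :=
      hg.continuous.continuousAt.comp (φ.continuousAt_symm hz)
    have h2 : (g ∘ φ.symm) (φ y) ∈ ψ.source := by
      rw [Function.comp_apply, φ.left_inv hys]
      exact hBq ⟨y, hy, rfl⟩
    filter_upwards [hc.preimage_mem_nhds (ψ.open_source.mem_nhds h2)] with z hz
    exact ψ.left_inv hz
  have hGz : G (φ y) ∈ ψ.target := by
    simp only [hG, Function.comp_apply, φ.left_inv hys]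
    exact ψ.map_source (hBq ⟨y, hy, rfl⟩)
  have hinv : Function.Injective (mfderiv (𝓡 2) (𝓡 2) (ψ.symm ∘ G) (φ y)) := by
    rw [hev.mfderiv_eq, mfderiv_comp_chart_symm hg p hz]
    exact ((hg' _).comp (isInvertible_mfderiv_chart_symm p hz)).injective
  have e1 := planeJacobian_comp_of_injective
    (mdifferentiableAt_atlas_symm (chart_mem_atlas _ q) hGz) (hGd y hy) hinv
  rw [planeJacobian_congr hev, planeJacobian_comp_chart_symm hg p hz] at e1
  have e2 : ψ.symm (G (φ y)) = g (φ.symm (φ y)) := hev.eq_of_nhds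
  have hpos := hμ.pos
  have p1 := hpos (φ.symm (φ y))
  have p2 := hpos (g (φ.symm (φ y)))
  have p3 := planeJacobian_chart_symm_pos p hz
  have p4 := jacobian_pos_of_isInvertible (hg' (φ.symm (φ y)))
  simp only
  rw [← ENNReal.ofReal_mul (abs_nonneg _), ← ENNReal.ofReal_mul
    (absDet_pos hpos (hg' _)).le, e2]
  congr 1
  rw [mul_left_comm, mul_comm |_|, ← e1, absDet]
  field_simp
  rfl

end ChangeOfVariables

/-! ### Local injectivity and finite fibres -/

section LocalInjectivity

variable {S : Type*} [TopologicalSpace S] [ChartedSpace Plane S] [IsManifold (𝓡 2) ∞ S]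

/-- The inverse function theorem in charts. The set is also shrunk so that it and its image lie in
single chart domains, as the change of variables requires. -/
theorem exists_isOpen_injOn {g : S → S} (hg : ContMDiff (𝓡 2) (𝓡 2) 1 g)
    (hg' : ∀ x, (mfderiv (𝓡 2) (𝓡 2) g x).IsInvertible) (p : S) :
    ∃ U : Set S, IsOpen U ∧ p ∈ U ∧ Set.InjOn g U ∧ U ⊆ (chartAt Plane p).source ∧
      g '' U ⊆ (chartAt Plane (g p)).source := by
  set φ := chartAt Plane p
  set ψ := chartAt Plane (g p)
  have hp : p ∈ φ.source := mem_chart_source Plane p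
  have hz := φ.map_source hp
  have hgp : (g ∘ φ.symm) (φ p) = g p := by rw [Function.comp_apply, φ.left_inv hp]
  have hq : (g ∘ φ.symm) (φ p) ∈ ψ.source := hgp ▸ mem_chart_source Plane (g p)
  have hM : IsManifold (𝓡 2) 1 S := IsManifold.of_le (n := ∞) (by exact_mod_cast le_top)
  have c1 : ContMDiffAt (𝓡 2) (𝓡 2) 1 (g ∘ φ.symm) (φ p) :=
    (hg.comp_contMDiffOn (contMDiffOn_chart_symm_one p)).contMDiffAt (φ.open_target.mem_nhds hz)
  have c2 : ContMDiffAt (𝓡 2) (𝓡 2) 1 ψ ((g ∘ φ.symm) (φ p)) :=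
    (contMDiffOn_chart (n := 1)).contMDiffAt (ψ.open_source.mem_nhds hq)
  have c3 : ContDiffAt ℝ 1 (ψ ∘ g ∘ φ.symm) (φ p) := contMDiffAt_iff_contDiffAt.1 (c2.comp _ c1)
  have hinv : (mfderiv (𝓡 2) (𝓡 2) (ψ ∘ g ∘ φ.symm) (φ p)).IsInvertible := by
    rw [mfderiv_comp _ (c2.mdifferentiableAt one_ne_zero) (c1.mdifferentiableAt one_ne_zero),
      mfderiv_comp_chart_symm hg p hz]
    have h1 : (mfderiv (𝓡 2) (𝓡 2) ψ ((g ∘ φ.symm) (φ p))).IsInvertible :=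
      ⟨(mdifferentiable_chart (I := 𝓡 2) (g p)).mfderiv hq, rfl⟩
    exact h1.comp ((hg' _).comp (isInvertible_mfderiv_chart_symm p hz))
  obtain ⟨(e : Plane ≃L[ℝ] Plane), he⟩ := hinv
  have hd : HasFDerivAt (ψ ∘ g ∘ φ.symm) (e : Plane →L[ℝ] Plane) (φ p) := by
    have := (c3.differentiableAt one_ne_zero).hasFDerivAt
    rw [← mfderiv_eq_fderiv, ← he] at this
    exact this
  set H := c3.toOpenPartialHomeomorph _ hd one_ne_zero
  have hHp : φ p ∈ H.source := c3.mem_toOpenPartialHomeomorph_source hd one_ne_zero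
  refine ⟨(φ.source ∩ φ ⁻¹' H.source) ∩ g ⁻¹' ψ.source, ?_, ?_, ?_, ?_, ?_⟩
  · exact (φ.isOpen_inter_preimage H.open_source).inter (ψ.open_source.preimage hg.continuous)
  · exact ⟨⟨hp, hHp⟩, mem_chart_source Plane (g p)⟩
  · rintro y ⟨⟨hy, hyH⟩, -⟩ y' ⟨⟨hy', hyH'⟩, -⟩ h
    refine φ.injOn hy hy' (H.injOn hyH hyH' ?_)
    change ψ (g (φ.symm (φ y))) = ψ (g (φ.symm (φ y')))
    rw [φ.left_inv hy, φ.left_inv hy', h]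
  · exact fun y hy => hy.1.1
  · rintro _ ⟨y, hy, rfl⟩
    exact hy.2

theorem finite_fibre [CompactSpace S] {g : S → S} (hg : ContMDiff (𝓡 2) (𝓡 2) 1 g)
    (hg' : ∀ x, (mfderiv (𝓡 2) (𝓡 2) g x).IsInvertible) (x : S) : {y | g y = x}.Finite := by
  choose U hUo hUp hUi _ _ using exists_isOpen_injOn hg hg'
  obtain ⟨t, ht⟩ := CompactSpace.elim_nhds_subcover U fun p => (hUo p).mem_nhds (hUp p)
  refine (t.finite_toSet.biUnion (t := fun p => U p ∩ {y | g y = x}) fun p _ => ?_).subset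
    fun y hy => ?_
  · refine Set.Subsingleton.finite fun y hy y' hy' => hUi p hy.1 hy'.1 ?_
    exact hy.2.trans hy'.2.symm
  · obtain ⟨p, hp, hyp⟩ : ∃ p ∈ t, y ∈ U p := by simpa using ht.ge (Set.mem_univ y)
    exact Set.mem_biUnion hp ⟨hyp, hy⟩

end LocalInjectivity

/-! ### Conditional law of the past coordinates -/

section Law

variable {S : Type*} {f : S → S} [MeasurableSpace S]

theorem measurable_coordinate (n : ℤ) : Measurable (fun x : NaturalExtension f => x.1 n) :=
  (measurable_pi_apply n).comp measurable_subtype_coe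

theorem measurableSet_coordinate_eq [MeasurableSingletonClass S] (n : ℤ) (y : S) :
    MeasurableSet {z : NaturalExtension f | z.1 n = y} :=
  measurable_coordinate n (measurableSet_singleton y)

variable [TopologicalSpace S] [ChartedSpace Plane S] [IsManifold (𝓡 2) ∞ S]
  [RiemannianBundle (fun x : S => TangentSpace (𝓡 2) x)]
  [IsContMDiffRiemannianBundle (𝓡 2) ∞ Plane (fun x : S => TangentSpace (𝓡 2) x)]
  [T2Space S] [CompactSpace S] [BorelSpace S]
  {μ : Measure S} [IsProbabilityMeasure μ] {ρ : S → ℝ}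
  {μ' : Measure (NaturalExtension f)} {κ : Kernel S (NaturalExtension f)}

/-- The conditional law of the coordinate of index `-n` on a set where `f^n` is injective. -/
theorem ae_law_of_injOn (hμ : IsSmoothVolume ρ μ) (hf : ContMDiff (𝓡 2) (𝓡 2) 1 f)
    (hf' : ∀ x, (mfderiv (𝓡 2) (𝓡 2) f x).IsInvertible) (hlift : IsLift μ μ')
    (hκ : IsDisintegration μ μ' κ) (n : ℕ) {U : Set S} (hU : MeasurableSet U)
    (hinj : Set.InjOn f^[n] U) {p q : S} (hp : U ⊆ (chartAt Plane p).source)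
    (hq : f^[n] '' U ⊆ (chartAt Plane q).source) :
    ∀ᵐ x ∂μ, ∀ y ∈ U, f^[n] y = x →
      κ x {z | z.1 (-n) = y} * ENNReal.ofReal (absDet ρ f^[n] y) = 1 := by
  set g := f^[n] with hgdef
  have hg : ContMDiff (𝓡 2) (𝓡 2) 1 g := contMDiff_iterate hf n
  have hg' := isInvertible_mfderiv_iterate hf hf' n
  have hcv : ∀ B : Set S, MeasurableSet B → B ⊆ U →
      MeasurableSet (g '' B) ∧ μ (g '' B) = ∫⁻ y in B, ENNReal.ofReal (absDet ρ g y) ∂μ :=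
    fun B hB hBU => measure_image_eq_setLIntegral_absDet hμ hg hg' hB (hinj.mono hBU)
      (hBU.trans hp) ((Set.image_mono hBU).trans hq)
  have hgm : Measurable g := hg.continuous.measurable
  have hw : Measurable (fun y => ENNReal.ofReal (absDet ρ g y)) :=
    (continuous_absDet hμ.contMDiff.continuous hμ.pos hg).measurable.ennreal_ofReal
  set m : S → ENNReal := fun x => κ x {z | z.1 (-n) ∈ U} with hm
  have hmm : Measurable m := κ.measurable_coe (measurable_coordinate _ hU)
  have hgU := (hcv U hU subset_rfl).1
  have hmap : μ.restrict (g '' U) =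
      ((μ.restrict U).withDensity fun y => ENNReal.ofReal (absDet ρ g y)).map g := by
    ext C hC
    rw [Measure.map_apply hgm hC, withDensity_apply _ (hgm hC), Measure.restrict_restrict (hgm hC),
      Measure.restrict_apply hC, ← (hcv (g ⁻¹' C ∩ U) ((hgm hC).inter hU) Set.inter_subset_right).2,
      Set.image_preimage_inter]
  have hae : ∀ᵐ x ∂μ, ∀ᵐ z ∂κ x, g (z.1 (-n)) = x := by
    filter_upwards [hκ.ae_fibre] with x hx
    filter_upwards [hx] with z hz
    rw [hgdef, NaturalExtension.iterate_apply, hz]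
  -- Disintegrating `μ B` as the probability of `x_{-n} ∈ B` gives the integral of `m` over `g ''
  -- B`, because by injectivity, over a point of `g '' B`, landing in `B` and landing in `U` are
  -- almost surely the same. Pulling back by `g` shows that the integrand has integral `μ B` over
  -- every such `B`, so it is `1` almost everywhere on `U`.
  have hB1 : ∀ B : Set S, MeasurableSet B → B ⊆ U →
      μ B = ∫⁻ y in B, m (g y) * ENNReal.ofReal (absDet ρ g y) ∂μ := by
    intro B hB hBU
    have hgB := (hcv B hB hBU).1
    have e1 : μ B = ∫⁻ x, κ x {z | z.1 (-n) ∈ B} ∂μ := by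
      have h1 := hκ.lintegral_eq {z | z.1 (-n) ∈ B} (measurable_coordinate _ hB)
      rw [← h1]
      exact (hlift.2 (-n) (by simp) B hB).symm
    have e2 : ∫⁻ x, κ x {z | z.1 (-n) ∈ B} ∂μ = ∫⁻ x, (g '' B).indicator m x ∂μ := by
      refine lintegral_congr_ae ?_
      filter_upwards [hae] with x hx
      by_cases hxB : x ∈ g '' B
      · rw [Set.indicator_of_mem hxB, hm]
        refine measure_congr ?_
        filter_upwards [hx] with z hz
        refine propext ⟨fun h => hBU h, fun h => ?_⟩
        obtain ⟨y, hy, rfl⟩ := hxB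
        have : z.1 (-n) = y := hinj h (hBU hy) hz
        exact (this ▸ hy : z.1 (-n) ∈ B)
      · rw [Set.indicator_of_notMem hxB]
        refine measure_eq_zero_iff_ae_notMem.2 ?_
        filter_upwards [hx] with z hz h
        exact hxB ⟨_, h, hz⟩
    have e3 : ∫⁻ x, (g '' B).indicator m x ∂μ = ∫⁻ x in g '' U, (g '' B).indicator m x ∂μ := by
      rw [lintegral_indicator hgB, lintegral_indicator hgB, Measure.restrict_restrict hgB,
        Set.inter_eq_left.2 (Set.image_mono hBU)]
    rw [e1, e2, e3, hmap, lintegral_map (hmm.indicator hgB) hgm]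
    have e4 : ∫⁻ y in B, m (g y) * ENNReal.ofReal (absDet ρ g y) ∂μ =
        ∫⁻ y in U, B.indicator (fun y => m (g y) * ENNReal.ofReal (absDet ρ g y)) y ∂μ := by
      rw [lintegral_indicator hB, Measure.restrict_restrict hB, Set.inter_eq_left.2 hBU]
    rw [e4]
    refine (lintegral_withDensity_eq_lintegral_mul _ hw ((hmm.indicator hgB).comp hgm)).trans ?_
    refine setLIntegral_congr_fun hU fun y hy => ?_
    by_cases hyB : y ∈ B
    · simp [hyB, Set.mem_image_of_mem g hyB, mul_comm]
    · have : g y ∉ g '' B := fun ⟨y', hy', h⟩ => hyB (hinj (hBU hy') hy h ▸ hy')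
      simp [hyB, this]
  have hF : Measurable fun y => m (g y) * ENNReal.ofReal (absDet ρ g y) :=
    (hmm.comp hgm).mul hw
  have hone : (fun y => m (g y) * ENNReal.ofReal (absDet ρ g y)) =ᵐ[μ.restrict U] fun _ => 1 := by
    refine ae_eq_of_forall_setLIntegral_eq_of_sigmaFinite hF measurable_const fun s hs _ => ?_
    rw [Measure.restrict_restrict hs, ← hB1 _ (hs.inter hU) Set.inter_subset_right]
    simp
  -- The exceptional set consists of points `y`, but the claim is for almost every `x = g y`: its
  -- image must be null too, by change of variables.
  set N : Set S := {y | m (g y) * ENNReal.ofReal (absDet ρ g y) ≠ 1} ∩ U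
  have hN : MeasurableSet N := (hF (measurableSet_singleton 1).compl).inter hU
  have hN0 : μ N = 0 := by
    have := ae_iff.1 hone
    rwa [Measure.restrict_apply' hU] at this
  have hgN : μ (g '' N) = 0 := by
    rw [(hcv N hN Set.inter_subset_right).2]
    exact setLIntegral_measure_zero _ _ hN0
  filter_upwards [hae, measure_eq_zero_iff_ae_notMem.1 hgN] with x hx hxN y hy hyx
  have h1 : m (g y) * ENNReal.ofReal (absDet ρ g y) = 1 := by
    by_contra h
    exact hxN ⟨y, ⟨h, hy⟩, hyx⟩
  have h2 : κ x {z | z.1 (-n) = y} = m (g y) := by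
    rw [hyx, hm]
    refine measure_congr ?_
    filter_upwards [hx] with z hz
    refine propext ⟨fun h => ?_, fun h => hinj h hy (hz.trans hyx.symm)⟩
    have h' : z.1 (-n) = y := h
    exact (h' ▸ hy : z.1 (-n) ∈ U)
  rw [h2, h1]

/-- The conditional law of the coordinate of index `-n`. -/
theorem ae_law (hμ : IsSmoothVolume ρ μ) (hf : ContMDiff (𝓡 2) (𝓡 2) 1 f)
    (hf' : ∀ x, (mfderiv (𝓡 2) (𝓡 2) f x).IsInvertible) (hlift : IsLift μ μ')
    (hκ : IsDisintegration μ μ' κ) : ∀ᵐ x ∂μ, ∀ (n : ℕ) (y : S), f^[n] y = x →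
      κ x {z | z.1 (-n) = y} = ENNReal.ofReal (1 / absDet ρ f^[n] y) := by
  refine ae_all_iff.2 fun n => ?_
  choose U hUo hUp hUi hU1 hU2 using
    exists_isOpen_injOn (contMDiff_iterate hf n) (isInvertible_mfderiv_iterate hf hf' n)
  obtain ⟨t, ht⟩ := CompactSpace.elim_nhds_subcover U fun p => (hUo p).mem_nhds (hUp p)
  have h : ∀ᵐ x ∂μ, ∀ p ∈ t, ∀ y ∈ U p, f^[n] y = x →
      κ x {z | z.1 (-n) = y} * ENNReal.ofReal (absDet ρ f^[n] y) = 1 :=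
    (ae_ball_iff t.countable_toSet).2 fun p _ => ae_law_of_injOn hμ hf hf' hlift hκ n
      (hUo p).measurableSet (hUi p) (hU1 p) (hU2 p)
  filter_upwards [h] with x hx y hyx
  obtain ⟨p, hp, hyp⟩ : ∃ p ∈ t, y ∈ U p := by simpa using ht.ge (Set.mem_univ y)
  have h1 := hx p hp y hyp hyx
  rw [one_div, ENNReal.ofReal_inv_of_pos
    (absDet_pos hμ.pos (isInvertible_mfderiv_iterate hf hf' n y))]
  exact ENNReal.eq_inv_of_mul_eq_one_left h1

end Law

/-! ### The transfer operator and one-block expansion -/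

section Transfer

variable {S : Type*} [TopologicalSpace S] [ChartedSpace Plane S]
  [RiemannianBundle (fun x : S => TangentSpace (𝓡 2) x)]

open Classical in
/-- The transfer operator `g ↦ ∑_{f^n(y) = x} g(y) / |det df^n_y|`. -/
def transfer (ρ : S → ℝ) (f : S → S) (n : ℕ) (g : S → ENNReal) (x : S) : ENNReal :=
  ∑' y : S, if f^[n] y = x then ENNReal.ofReal (1 / absDet ρ f^[n] y) * g y else 0

open Classical in
/-- `‖(df^n_y)⁻¹ v‖` when `f^n(y) = x`, and zero otherwise. -/
def backNorm (f : S → S) (n : ℕ) (x : S) (v : TangentSpace (𝓡 2) x) (y : S) : ℝ :=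
  if h : f^[n] y = x then ‖pullBack f n h v‖ else 0

theorem backNorm_eq (f : S → S) {n : ℕ} {x y : S} (h : f^[n] y = x) (v : TangentSpace (𝓡 2) x) :
    backNorm f n x v y = ‖pullBack f n h v‖ := dif_pos h

variable {ρ : S → ℝ} {f : S → S}

theorem transfer_mono {n : ℕ} {g h : S → ENNReal} {x : S}
    (hgh : ∀ y, f^[n] y = x → g y ≤ h y) : transfer ρ f n g x ≤ transfer ρ f n h x := by
  refine ENNReal.tsum_le_tsum fun y => ?_
  split_ifs with hy
  · gcongr
    exact hgh y hy
  · rfl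

theorem transfer_congr {n : ℕ} {g h : S → ENNReal} {x : S}
    (hgh : ∀ y, f^[n] y = x → g y = h y) : transfer ρ f n g x = transfer ρ f n h x :=
  le_antisymm (transfer_mono fun y hy => (hgh y hy).le) (transfer_mono fun y hy => (hgh y hy).ge)

theorem transfer_const_mul (n : ℕ) (a : ENNReal) (g : S → ENNReal) (x : S) :
    transfer ρ f n (fun y => a * g y) x = a * transfer ρ f n g x := by
  rw [transfer, transfer, ← ENNReal.tsum_mul_left]
  refine tsum_congr fun y => ?_
  split_ifs
  · exact mul_left_comm _ _ _
  · rw [mul_zero]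

theorem transfer_eq_sum {n : ℕ} {x : S} {s : Finset S} (hs : ∀ y, y ∈ s ↔ f^[n] y = x)
    (g : S → ENNReal) :
    transfer ρ f n g x = ∑ y ∈ s, ENNReal.ofReal (1 / absDet ρ f^[n] y) * g y := by
  rw [transfer, tsum_eq_sum (s := s) fun y hy => if_neg fun h => hy ((hs y).2 h)]
  exact Finset.sum_congr rfl fun y hy => if_pos ((hs y).1 hy)

/-- After exchanging the sums, each `z` contributes only through `y = f^m(z)`, and the weights
multiply by the chain rule. This is the Markov property of the backward orbit. -/
theorem transfer_add (hρ : ∀ x, 0 < ρ x) (hf : ContMDiff (𝓡 2) (𝓡 2) 1 f)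
    (hf' : ∀ x, (mfderiv (𝓡 2) (𝓡 2) f x).IsInvertible) (n m : ℕ) (g : S → ENNReal) (x : S) :
    transfer ρ f (n + m) g x = transfer ρ f n (transfer ρ f m g) x := by
  classical
  have h1 : ∀ y, (if f^[n] y = x then
      ENNReal.ofReal (1 / absDet ρ f^[n] y) * transfer ρ f m g y else 0) =
      ∑' z, if f^[n] y = x then (if f^[m] z = y then ENNReal.ofReal (1 / absDet ρ f^[n] y) *
        (ENNReal.ofReal (1 / absDet ρ f^[m] z) * g z) else 0) else 0 := by
    intro y
    split_ifs
    · rw [transfer, ← ENNReal.tsum_mul_left]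
      exact tsum_congr fun z => mul_ite_zero _ _ _
    · exact tsum_zero.symm
  rw [transfer, transfer, tsum_congr h1, ENNReal.tsum_comm]
  refine tsum_congr fun z => ?_
  rw [tsum_eq_single (f^[m] z) fun y hy => by
    split_ifs with h2 h3
    · exact absurd h3.symm hy
    · rfl
    · rfl, if_pos rfl, Function.iterate_add_apply, absDet_iterate_add hρ hf hf',
    ← mul_assoc, ← ENNReal.ofReal_mul (one_div_pos.2
      (absDet_pos hρ (isInvertible_mfderiv_iterate hf hf' n _))).le, one_div_mul_one_div]

theorem norm_pullBack_bounds (hf : ContMDiff (𝓡 2) (𝓡 2) 1 f)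
    (hf' : ∀ x, (mfderiv (𝓡 2) (𝓡 2) f x).IsInvertible) {L : ℝ} (hL1 : 1 ≤ L)
    (hL : ∀ (y : S) (u : TangentSpace (𝓡 2) y),
      ‖mfderiv (𝓡 2) (𝓡 2) f y u‖ ≤ L * ‖u‖ ∧ ‖u‖ ≤ L * ‖mfderiv (𝓡 2) (𝓡 2) f y u‖)
    (n : ℕ) {x y : S} (h : f^[n] y = x) (v : TangentSpace (𝓡 2) x) :
    ‖pullBack f n h v‖ ≤ L ^ n * ‖v‖ ∧ ‖v‖ ≤ L ^ n * ‖pullBack f n h v‖ := by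
  induction n generalizing y with
  | zero =>
    subst h
    have h0 : ∀ F : S → S, F = id → ∀ u : TangentSpace (𝓡 2) (F y),
        ‖(mfderiv (𝓡 2) (𝓡 2) F y).inverse u‖ = ‖u‖ := by
      rintro _ rfl u
      rw [mfderiv_id, ContinuousLinearMap.inverse_id]
      rfl
    have : ‖pullBack f 0 rfl v‖ = ‖v‖ := h0 _ f.iterate_zero v
    rw [pow_zero, one_mul, one_mul, this]
    exact ⟨le_rfl, le_rfl⟩
  | succ n ih =>
    have hy : f^[n] (f^[1] y) = x := h
    rw [pullBack_add hf hf' (m := 1) rfl hy h]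
    obtain ⟨i1, i2⟩ := ih hy
    generalize pullBack f n hy v = u at i1 i2 ⊢
    have h1 : ∀ F : S → S, F = f → ∀ u : TangentSpace (𝓡 2) (F y),
        ‖(mfderiv (𝓡 2) (𝓡 2) F y).inverse u‖ ≤ L * ‖u‖ ∧
        ‖u‖ ≤ L * ‖(mfderiv (𝓡 2) (𝓡 2) F y).inverse u‖ := by
      rintro F rfl u
      have := hL y ((mfderiv (𝓡 2) (𝓡 2) F y).inverse u)
      rw [(hf' y).self_apply_inverse] at this
      exact ⟨this.2, this.1⟩
    obtain ⟨j1, j2⟩ : ‖pullBack f 1 rfl u‖ ≤ L * ‖u‖ ∧ ‖u‖ ≤ L * ‖pullBack f 1 rfl u‖ :=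
      h1 _ f.iterate_one u
    have hLn : 0 ≤ L ^ n := by positivity
    constructor
    · calc _ ≤ L * ‖u‖ := j1
        _ ≤ L * (L ^ n * ‖v‖) := by gcongr
        _ = _ := by ring
    · calc ‖v‖ ≤ L ^ n * ‖u‖ := i2
        _ ≤ L ^ n * (L * ‖pullBack f 1 rfl u‖) := by gcongr
        _ = _ := by ring

theorem pullBack_ne_zero {n : ℕ} (hf' : ∀ x, (mfderiv (𝓡 2) (𝓡 2) f^[n] x).IsInvertible)
    {x y : S} (h : f^[n] y = x) {v : TangentSpace (𝓡 2) x} (hv : v ≠ 0) :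
    pullBack f n h v ≠ 0 := by
  subst h
  intro h0
  apply hv
  have := mfderiv_pullBack (hf' y) v
  rw [h0, map_zero] at this
  exact this.symm

/-- The default values of real suprema and infima do no harm: a family of nonpositive reals has
supremum at most `0`, bounded or not, and an infimum over a family not bounded below is `0`, so a
positive one is a genuine lower bound. -/
theorem exists_pastExpansion_ge (h : 0 < pastExpansionRate ρ f) :
    ∃ (n : ℕ) (c : ℝ), 0 < n ∧ 0 < c ∧ ∀ (x : S) (v : TangentSpace (𝓡 2) x), ‖v‖ = 1 →
      c ≤ pastExpansion ρ f n x v := by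
  obtain ⟨n, hn⟩ : ∃ n : ℕ+, 0 < (1 / (n : ℝ)) *
      ⨅ v : {v : Σ x : S, TangentSpace (𝓡 2) x // ‖v.2‖ = 1},
        pastExpansion ρ f n v.1.1 v.1.2 := by
    by_contra! hn
    exact absurd h (not_lt.2 (Real.iSup_nonpos hn))
  have hn0 : (0 : ℝ) < n := by exact_mod_cast n.pos
  have hc := (mul_pos_iff_of_pos_left (one_div_pos.2 hn0)).1 hn
  refine ⟨n, _, n.pos, hc, fun x v hv => ?_⟩
  refine ciInf_le (f := fun v : {v : Σ x : S, TangentSpace (𝓡 2) x // ‖v.2‖ = 1} =>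
    pastExpansion ρ f n v.1.1 v.1.2) ?_ ⟨⟨x, v⟩, hv⟩
  by_contra hb
  exact hc.ne' (Real.iInf_of_not_bddBelow hb)

end Transfer

/-! ### Contraction of small negative moments -/

section Moments

variable {S : Type*} [TopologicalSpace S] [ChartedSpace Plane S]
  [RiemannianBundle (fun x : S => TangentSpace (𝓡 2) x)] {ρ : S → ℝ} {f : S → S}

theorem backNorm_smul (n : ℕ) {x y : S} (h : f^[n] y = x) (r : ℝ) (v : TangentSpace (𝓡 2) x) :
    backNorm f n x (r • v) y = |r| * backNorm f n x v y := by
  rw [backNorm_eq f h, backNorm_eq f h, ← pullBackLin_apply, map_smul, norm_smul, Real.norm_eq_abs,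
    pullBackLin_apply]

theorem pastExpansion_eq_sum {n : ℕ} {x : S} {s : Finset S} (hs : ∀ y, y ∈ s ↔ f^[n] y = x)
    (v : TangentSpace (𝓡 2) x) :
    pastExpansion ρ f n x v = ∑ y ∈ s, 1 / absDet ρ f^[n] y * Real.log (backNorm f n x v y) := by
  set F : S → ℝ := fun y => 1 / absDet ρ f^[n] y * Real.log (backNorm f n x v y)
  have h1 : pastExpansion ρ f n x v = ∑' y : {y | f^[n] y = x}, F y := by
    refine tsum_congr fun y => ?_
    simp only [F]
    rw [backNorm_eq f y.2, div_eq_mul_one_div, mul_comm]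
  have h2 : ∀ y ∉ s, {y | f^[n] y = x}.indicator F y = 0 := fun y hy =>
    Set.indicator_of_notMem (s := {y | f^[n] y = x}) (fun h => hy ((hs y).2 h)) _
  rw [h1, tsum_subtype, tsum_eq_sum h2]
  exact Finset.sum_congr rfl fun y hy =>
    Set.indicator_of_mem (s := {y | f^[n] y = x}) ((hs y).1 hy) _

/-- This is `exp t ≤ 1 + t + t²` for `|t| ≤ 1`, at `t = -δ log a`. -/
theorem rpow_neg_le_quadratic {a K δ : ℝ} (ha : 0 < a) (hδ : 0 ≤ δ) (hK : |Real.log a| ≤ K)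
    (hδK : δ * K ≤ 1) : a ^ (-δ) ≤ 1 - δ * Real.log a + (δ * K) ^ 2 := by
  have h1 : |-δ * Real.log a| ≤ δ * K := by
    rw [abs_mul, abs_neg, abs_of_nonneg hδ]
    gcongr
  have h2 := (abs_le.1 (Real.abs_exp_sub_one_sub_id_le (h1.trans hδK))).2
  have h3 : (-δ * Real.log a) ^ 2 ≤ (δ * K) ^ 2 := by
    rw [← sq_abs]
    gcongr
  rw [Real.rpow_def_of_pos ha, mul_comm (Real.log a)]
  linarith

/-- An average expansion of the logarithms yields a contraction of small negative moments. -/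
theorem sum_mul_rpow_neg_le {ι : Type*} {s : Finset ι} {w a : ι → ℝ} {K c : ℝ}
    (hw : ∀ y ∈ s, 0 ≤ w y) (hw1 : ∑ y ∈ s, w y = 1) (ha : ∀ y ∈ s, 0 < a y)
    (hK : ∀ y ∈ s, |Real.log (a y)| ≤ K) (hc : c ≤ ∑ y ∈ s, w y * Real.log (a y))
    {δ : ℝ} (hδ : 0 ≤ δ) (hδK : δ * K ≤ 1) (hδc : δ * K ^ 2 ≤ c / 2) :
    ∑ y ∈ s, w y * a y ^ (-δ) ≤ 1 - δ * (c / 2) := by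
  calc ∑ y ∈ s, w y * a y ^ (-δ)
      ≤ ∑ y ∈ s, w y * (1 - δ * Real.log (a y) + (δ * K) ^ 2) :=
        Finset.sum_le_sum fun y hy => mul_le_mul_of_nonneg_left
          (rpow_neg_le_quadratic (ha y hy) hδ (hK y hy) hδK) (hw y hy)
    _ = (1 + (δ * K) ^ 2) * ∑ y ∈ s, w y - δ * ∑ y ∈ s, w y * Real.log (a y) := by
        rw [Finset.mul_sum, Finset.mul_sum, ← Finset.sum_sub_distrib]
        exact Finset.sum_congr rfl fun y _ => by ring
    _ ≤ 1 + (δ * K) ^ 2 - δ * c := by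
        rw [hw1, mul_one]
        gcongr
    _ ≤ _ := by nlinarith

/-- The points all of whose preorbits carry a probability. -/
def IsRegular (ρ : S → ℝ) (f : S → S) (x : S) : Prop :=
  ∀ (n : ℕ) (y : S), f^[n] y = x → ∀ m, transfer ρ f m (fun _ => 1) y = 1

theorem IsRegular.of_iterate {x y : S} (hx : IsRegular ρ f x) {n : ℕ} (h : f^[n] y = x) :
    IsRegular ρ f y := fun m z hz => hx (n + m) z (by rw [Function.iterate_add_apply, hz, h])

variable [IsManifold (𝓡 2) ∞ S] [CompactSpace S]

theorem exists_transfer_contraction (hρ : ∀ x, 0 < ρ x) (hf : ContMDiff (𝓡 2) (𝓡 2) 1 f)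
    (hf' : ∀ x, (mfderiv (𝓡 2) (𝓡 2) f x).IsInvertible) (hrate : 0 < pastExpansionRate ρ f)
    {L : ℝ} (hL1 : 1 ≤ L) (hL : ∀ (y : S) (u : TangentSpace (𝓡 2) y),
      ‖mfderiv (𝓡 2) (𝓡 2) f y u‖ ≤ L * ‖u‖ ∧ ‖u‖ ≤ L * ‖mfderiv (𝓡 2) (𝓡 2) f y u‖) :
    ∃ (N : ℕ) (δ q : ℝ), 0 < N ∧ 0 < δ ∧ δ ≤ 2 ∧ 0 < q ∧ q < 1 ∧
      ∀ x, transfer ρ f N (fun _ => 1) x = 1 → ∀ v : TangentSpace (𝓡 2) x, v ≠ 0 →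
        transfer ρ f N (fun y => ENNReal.ofReal (backNorm f N x v y ^ (-δ))) x ≤
          ENNReal.ofReal (q * ‖v‖ ^ (-δ)) := by
  obtain ⟨N, c, hN, hc, hNc⟩ := exists_pastExpansion_ge hrate
  have hfN := isInvertible_mfderiv_iterate hf hf' N
  set K : ℝ := N * Real.log L
  have hK0 : 0 ≤ K := mul_nonneg (Nat.cast_nonneg _) (Real.log_nonneg hL1)
  -- In order: `δ ≤ 2` for `tsum_inv_sq_le`, `δ K ≤ 1` for the Taylor bound, and a quadratic error
  -- `(δ K)²` that absorbs at most half of the gain `δ c`.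
  set δ : ℝ := min (min 2 (1 / (K + 1))) (c / (2 * (K ^ 2 + 1)))
  have hδ0 : 0 < δ := lt_min (lt_min two_pos (by positivity)) (by positivity)
  have hδ2 : δ ≤ 2 := (min_le_left _ _).trans (min_le_left _ _)
  have hδK : δ * K ≤ 1 := by
    have : δ ≤ 1 / (K + 1) := (min_le_left _ _).trans (min_le_right _ _)
    rw [le_div_iff₀ (by positivity)] at this
    nlinarith
  have hδc : δ * K ^ 2 ≤ c / 2 := by
    have : δ ≤ c / (2 * (K ^ 2 + 1)) := min_le_right _ _
    rw [le_div_iff₀ (by positivity)] at this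
    nlinarith
  -- The maximum with `1/2` keeps `q` positive, since an `N`-th root of it is taken later.
  refine ⟨N, δ, max (1 - δ * (c / 2)) (1 / 2), hN, hδ0, hδ2, lt_max_of_lt_right (by norm_num),
    max_lt (by nlinarith) (by norm_num), fun x hx => ?_⟩
  obtain ⟨s, hs⟩ : ∃ s : Finset S, ∀ y, y ∈ s ↔ f^[N] y = x :=
    ⟨(finite_fibre (contMDiff_iterate hf N) hfN x).toFinset, fun y => by simp⟩
  have hw : ∀ y ∈ s, 0 ≤ 1 / absDet ρ f^[N] y := fun y _ =>
    (one_div_pos.2 (absDet_pos hρ (hfN y))).le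
  have hw1 : ∑ y ∈ s, 1 / absDet ρ f^[N] y = 1 := by
    rw [transfer_eq_sum hs] at hx
    simp only [mul_one] at hx
    rwa [← ENNReal.ofReal_sum_of_nonneg hw, ENNReal.ofReal_eq_one] at hx
  have hunit : ∀ v : TangentSpace (𝓡 2) x, ‖v‖ = 1 →
      transfer ρ f N (fun y => ENNReal.ofReal (backNorm f N x v y ^ (-δ))) x ≤
        ENNReal.ofReal (max (1 - δ * (c / 2)) (1 / 2)) := by
    intro v hv
    have hpos : ∀ y ∈ s, 0 < backNorm f N x v y := fun y hy => by
      rw [backNorm_eq f ((hs y).1 hy), norm_pos_iff]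
      exact pullBack_ne_zero hfN _ (norm_ne_zero_iff.1 (hv ▸ one_ne_zero))
    have hlog : ∀ y ∈ s, |Real.log (backNorm f N x v y)| ≤ K := fun y hy => by
      have h0 := hpos y hy
      obtain ⟨h1, h2⟩ := norm_pullBack_bounds hf hf' hL1 hL N ((hs y).1 hy) v
      rw [← backNorm_eq f ((hs y).1 hy), hv] at h1 h2
      have hL0 : 0 < L ^ N := by positivity
      have e1 := Real.log_le_log h0 h1
      have e2 := Real.log_le_log one_pos h2
      rw [Real.log_mul hL0.ne' h0.ne', Real.log_one, Real.log_pow] at e2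
      rw [mul_one, Real.log_pow] at e1
      exact abs_le.2 ⟨by linarith, e1⟩
    rw [transfer_eq_sum hs]
    have hNv := hNc x v hv
    rw [pastExpansion_eq_sum hs] at hNv
    have hmain := sum_mul_rpow_neg_le hw hw1 hpos hlog hNv hδ0.le hδK hδc
    calc _ = ENNReal.ofReal (∑ y ∈ s, 1 / absDet ρ f^[N] y * backNorm f N x v y ^ (-δ)) := by
          rw [ENNReal.ofReal_sum_of_nonneg fun y hy =>
            mul_nonneg (hw y hy) (Real.rpow_nonneg (hpos y hy).le _)]
          exact Finset.sum_congr rfl fun y hy => (ENNReal.ofReal_mul (hw y hy)).symm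
      _ ≤ _ := ENNReal.ofReal_le_ofReal (hmain.trans (le_max_left _ _))
  intro v hv
  have hr : 0 < ‖v‖ := norm_pos_iff.2 hv
  have hu : ‖‖v‖⁻¹ • v‖ = 1 := by
    rw [norm_smul, norm_inv, norm_norm, inv_mul_cancel₀ hr.ne']
  have hvu : v = ‖v‖ • (‖v‖⁻¹ • v) := by rw [smul_smul, mul_inv_cancel₀ hr.ne', one_smul]
  generalize ‖v‖⁻¹ • v = u at hu hvu
  generalize ‖v‖ = r at hr hvu
  have h1 : transfer ρ f N (fun y => ENNReal.ofReal (backNorm f N x v y ^ (-δ))) x =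
      transfer ρ f N (fun y => ENNReal.ofReal (r ^ (-δ)) *
        ENNReal.ofReal (backNorm f N x u y ^ (-δ))) x := by
    refine transfer_congr fun y hy => ?_
    rw [hvu, backNorm_smul N hy, abs_of_pos hr, Real.mul_rpow hr.le
      (by rw [backNorm_eq f hy]; exact norm_nonneg _),
      ENNReal.ofReal_mul (Real.rpow_nonneg hr.le _)]
  rw [h1, transfer_const_mul, mul_comm, ENNReal.ofReal_mul (lt_max_of_lt_right (by norm_num)).le]
  gcongr
  exact hunit u hu

end Moments

/-! ### Exponential decay of negative moments -/

section MomentDecay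

variable {S : Type*} [TopologicalSpace S] [ChartedSpace Plane S]
  [RiemannianBundle (fun x : S => TangentSpace (𝓡 2) x)] {ρ : S → ℝ} {f : S → S}

theorem backNorm_pos (hf : ContMDiff (𝓡 2) (𝓡 2) 1 f)
    (hf' : ∀ x, (mfderiv (𝓡 2) (𝓡 2) f x).IsInvertible) {n : ℕ} {x y : S} (h : f^[n] y = x)
    {v : TangentSpace (𝓡 2) x} (hv : v ≠ 0) : 0 < backNorm f n x v y := by
  rw [backNorm_eq f h, norm_pos_iff]
  exact pullBack_ne_zero (isInvertible_mfderiv_iterate hf hf' n) h hv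

theorem backNorm_add (hf : ContMDiff (𝓡 2) (𝓡 2) 1 f)
    (hf' : ∀ x, (mfderiv (𝓡 2) (𝓡 2) f x).IsInvertible) {n m : ℕ} {x y z : S} (h : f^[n] y = x)
    (h' : f^[m] z = y) (v : TangentSpace (𝓡 2) x) :
    backNorm f (n + m) x v z = backNorm f m y (pullBack f n h v) z := by
  have h3 : f^[n + m] z = x := by rw [Function.iterate_add_apply, h', h]
  rw [backNorm_eq f h3, backNorm_eq f h', pullBack_add hf hf' h' h h3]

/-- Blocks of length `N` are peeled off by strong induction, with `r = q^{1/N}`; regularity passes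
to preimages, so the induction hypothesis applies at each of them. An incomplete block costs at most
`(L^N)^δ`, and dividing by `q = r^N` makes up for `r^n` when `n < N`. -/
theorem exists_moment_bound (hρ : ∀ x, 0 < ρ x) (hf : ContMDiff (𝓡 2) (𝓡 2) 1 f)
    (hf' : ∀ x, (mfderiv (𝓡 2) (𝓡 2) f x).IsInvertible)
    {L : ℝ} (hL1 : 1 ≤ L) (hL : ∀ (y : S) (u : TangentSpace (𝓡 2) y),
      ‖mfderiv (𝓡 2) (𝓡 2) f y u‖ ≤ L * ‖u‖ ∧ ‖u‖ ≤ L * ‖mfderiv (𝓡 2) (𝓡 2) f y u‖)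
    {N : ℕ} {δ q : ℝ} (hN : 0 < N) (hδ : 0 < δ) (hq : 0 < q) (hq1 : q < 1)
    (hstep : ∀ x, transfer ρ f N (fun _ => 1) x = 1 → ∀ v : TangentSpace (𝓡 2) x, v ≠ 0 →
        transfer ρ f N (fun y => ENNReal.ofReal (backNorm f N x v y ^ (-δ))) x ≤
          ENNReal.ofReal (q * ‖v‖ ^ (-δ))) :
    ∃ C r : ℝ, 0 < C ∧ 0 < r ∧ r < 1 ∧ ∀ x, IsRegular ρ f x →
      ∀ v : TangentSpace (𝓡 2) x, v ≠ 0 → ∀ n,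
        transfer ρ f n (fun y => ENNReal.ofReal (backNorm f n x v y ^ (-δ))) x ≤
          ENNReal.ofReal (C * r ^ n * ‖v‖ ^ (-δ)) := by
  have hL0 : 0 < L := by linarith
  set r : ℝ := q ^ (1 / (N : ℝ))
  have hN' : (0 : ℝ) < N := by exact_mod_cast hN
  have hr0 : 0 < r := Real.rpow_pos_of_pos hq _
  have hr1 : r < 1 := Real.rpow_lt_one hq.le hq1 (by positivity)
  have hrN : r ^ N = q := by
    rw [← Real.rpow_natCast, ← Real.rpow_mul hq.le, one_div_mul_cancel hN'.ne', Real.rpow_one]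
  have hC : 0 < (L ^ N) ^ δ / q := by positivity
  refine ⟨(L ^ N) ^ δ / q, r, hC, hr0, hr1, fun x hx v hv n => ?_⟩
  induction n using Nat.strong_induction_on generalizing x with
  | _ n ih =>
  rcases lt_or_ge n N with hn | hn
  · calc transfer ρ f n (fun y => ENNReal.ofReal (backNorm f n x v y ^ (-δ))) x
        ≤ transfer ρ f n (fun y => ENNReal.ofReal ((L ^ N) ^ δ * ‖v‖ ^ (-δ)) * 1) x := by
          refine transfer_mono fun y hy => ?_
          rw [mul_one]
          refine ENNReal.ofReal_le_ofReal ?_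
          have hv0 : 0 < ‖v‖ := norm_pos_iff.2 hv
          have h0 := backNorm_pos hf hf' hy hv
          have h1 := (norm_pullBack_bounds hf hf' hL1 hL n hy v).2
          rw [← backNorm_eq f hy] at h1
          have h2 : ‖v‖ / L ^ N ≤ backNorm f n x v y := by
            rw [div_le_iff₀ (by positivity), mul_comm]
            exact h1.trans (by gcongr)
          refine (Real.rpow_le_rpow_of_nonpos (by positivity) h2 (by linarith)).trans (le_of_eq ?_)
          rw [Real.div_rpow hv0.le (by positivity), Real.rpow_neg (by positivity : 0 ≤ L ^ N),
            div_inv_eq_mul, mul_comm]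
      _ = ENNReal.ofReal ((L ^ N) ^ δ * ‖v‖ ^ (-δ)) := by
          rw [transfer_const_mul, hx 0 x rfl n, mul_one]
      _ ≤ _ := by
          refine ENNReal.ofReal_le_ofReal ?_
          gcongr
          rw [div_mul_eq_mul_div, le_div_iff₀ hq, ← hrN]
          exact mul_le_mul_of_nonneg_left (pow_le_pow_of_le_one hr0.le hr1.le hn.le)
            (by positivity)
  · obtain ⟨m, rfl⟩ := Nat.exists_eq_add_of_le hn
    rw [transfer_add hρ hf hf']
    calc _ ≤ transfer ρ f N (fun y => ENNReal.ofReal ((L ^ N) ^ δ / q * r ^ m) *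
          ENNReal.ofReal (backNorm f N x v y ^ (-δ))) x := by
          refine transfer_mono fun y hy => ?_
          have h1 := ih m (by omega) y (hx.of_iterate hy) (pullBack f N hy v)
            (pullBack_ne_zero (isInvertible_mfderiv_iterate hf hf' N) hy hv)
          rw [← ENNReal.ofReal_mul (by positivity), backNorm_eq f hy]
          refine (le_of_eq (transfer_congr fun z hz => ?_)).trans h1
          rw [backNorm_add hf hf' hy hz]
      _ ≤ ENNReal.ofReal ((L ^ N) ^ δ / q * r ^ m) * ENNReal.ofReal (q * ‖v‖ ^ (-δ)) := by
          rw [transfer_const_mul]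
          gcongr
          exact hstep x (hx 0 x rfl N) v hv
      _ = _ := by
          rw [← ENNReal.ofReal_mul (by positivity), pow_add, hrN]
          congr 1
          ring

/-- Given `x_{-n} = y`, the ratio compares the vector pulled back to `y` with its further pullback
by `k` steps; the moment bound at `y` is homogeneous, so the length at time `n` cancels. -/
theorem transfer_ratio_le (hρ : ∀ x, 0 < ρ x) (hf : ContMDiff (𝓡 2) (𝓡 2) 1 f)
    (hf' : ∀ x, (mfderiv (𝓡 2) (𝓡 2) f x).IsInvertible) {δ C r : ℝ} {x : S}
    (hx : IsRegular ρ f x)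
    (h : ∀ x, IsRegular ρ f x → ∀ v : TangentSpace (𝓡 2) x, v ≠ 0 → ∀ n,
        transfer ρ f n (fun y => ENNReal.ofReal (backNorm f n x v y ^ (-δ))) x ≤
          ENNReal.ofReal (C * r ^ n * ‖v‖ ^ (-δ)))
    {v : TangentSpace (𝓡 2) x} (hv : v ≠ 0) (n k : ℕ) :
    transfer ρ f (n + k) (fun z => ENNReal.ofReal
      ((backNorm f n x v (f^[k] z) / backNorm f (n + k) x v z) ^ δ)) x ≤
        ENNReal.ofReal (C * r ^ k) := by
  rw [transfer_add hρ hf hf']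
  calc _ ≤ transfer ρ f n (fun _ => ENNReal.ofReal (C * r ^ k) * 1) x := by
        refine transfer_mono fun y hy => ?_
        have h0 := backNorm_pos hf hf' hy hv
        have h1 := h y (hx.of_iterate hy) (pullBack f n hy v)
            (pullBack_ne_zero (isInvertible_mfderiv_iterate hf hf' n) hy hv) k
        have h2 : transfer ρ f k (fun z => ENNReal.ofReal
            ((backNorm f n x v (f^[k] z) / backNorm f (n + k) x v z) ^ δ)) y =
            ENNReal.ofReal (backNorm f n x v y ^ δ) * transfer ρ f k (fun z =>
              ENNReal.ofReal (backNorm f k y (pullBack f n hy v) z ^ (-δ))) y := by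
          rw [← transfer_const_mul]
          refine transfer_congr fun z hz => ?_
          have h3 := backNorm_pos hf hf' hz
            (pullBack_ne_zero (isInvertible_mfderiv_iterate hf hf' n) hy hv)
          rw [hz, backNorm_add hf hf' hy hz, Real.div_rpow h0.le h3.le, Real.rpow_neg h3.le,
            ← ENNReal.ofReal_mul (Real.rpow_nonneg h0.le _), div_eq_mul_inv]
        rw [h2, mul_one]
        refine (mul_le_mul_right h1 _).trans (le_of_eq ?_)
        rw [← backNorm_eq f hy, ← ENNReal.ofReal_mul (Real.rpow_nonneg h0.le _), mul_left_comm,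
          Real.rpow_neg h0.le, mul_inv_cancel₀ (Real.rpow_pos_of_pos h0 _).ne', mul_one]
    _ = _ := by rw [transfer_const_mul, hx 0 x rfl n, mul_one]

end MomentDecay

/-! ### Integration against the pre-orbit law, and regular points -/

section Regularity

variable {S : Type*} {f : S → S} [MeasurableSpace S] [TopologicalSpace S] [ChartedSpace Plane S]
  [RiemannianBundle (fun x : S => TangentSpace (𝓡 2) x)] {ρ : S → ℝ}

/-- Under `m`, the coordinate of index `-n` is distributed on the fibre of `f^n` over `x`
with the weights `1 / |det df^n|`. -/
structure HasPreorbitLaw (ρ : S → ℝ) (x : S) (m : Measure (NaturalExtension f)) : Prop where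
  ae_eq : ∀ᵐ z ∂m, z.1 0 = x
  measure_eq : ∀ (n : ℕ) (y : S), f^[n] y = x →
    m {z | z.1 (-n) = y} = ENNReal.ofReal (1 / absDet ρ f^[n] y)

/-- Almost surely the coordinate takes finitely many values, so `g` needs no measurability. -/
theorem exists_ae_eq_sum_indicator [IsManifold (𝓡 2) ∞ S] [CompactSpace S] {x : S}
    {m : Measure (NaturalExtension f)}
    (hm : HasPreorbitLaw ρ x m) (hf : ContMDiff (𝓡 2) (𝓡 2) 1 f)
    (hf' : ∀ x, (mfderiv (𝓡 2) (𝓡 2) f x).IsInvertible) (n : ℕ) (g : S → ENNReal) :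
    ∃ s : Finset S, (∀ y, y ∈ s ↔ f^[n] y = x) ∧
      (fun z : NaturalExtension f => g (z.1 (-n))) =ᵐ[m] fun z => ∑ y ∈ s,
        {z : NaturalExtension f | z.1 (-n) = y}.indicator (fun _ => g y) z := by
  obtain ⟨s, hs⟩ : ∃ s : Finset S, ∀ y, y ∈ s ↔ f^[n] y = x :=
    ⟨(finite_fibre (contMDiff_iterate hf n) (isInvertible_mfderiv_iterate hf hf' n) x).toFinset,
      fun y => by simp⟩
  refine ⟨s, hs, ?_⟩
  filter_upwards [hm.ae_eq] with z hz
  have hzs : z.1 (-n) ∈ s := (hs _).2 (by rw [z.iterate_apply, hz])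
  rw [Finset.sum_eq_single_of_mem _ hzs fun y _ hy =>
    Set.indicator_of_notMem (s := {z : NaturalExtension f | z.1 (-n) = y}) (fun h => hy h.symm) _,
    Set.indicator_of_mem (s := {z' : NaturalExtension f | z'.1 (-n) = z.1 (-n)}) rfl]

theorem aemeasurable_comp_coordinate [IsManifold (𝓡 2) ∞ S] [CompactSpace S]
    [MeasurableSingletonClass S] {x : S} {m : Measure (NaturalExtension f)}
    (hm : HasPreorbitLaw ρ x m) (hf : ContMDiff (𝓡 2) (𝓡 2) 1 f)
    (hf' : ∀ x, (mfderiv (𝓡 2) (𝓡 2) f x).IsInvertible) (n : ℕ) (g : S → ENNReal) :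
    AEMeasurable (fun z : NaturalExtension f => g (z.1 (-n))) m := by
  obtain ⟨s, -, h⟩ := exists_ae_eq_sum_indicator hm hf hf' n g
  refine AEMeasurable.congr ?_ h.symm
  exact (Finset.measurable_fun_sum s fun y _ =>
    measurable_const.indicator (measurableSet_coordinate_eq _ y)).aemeasurable

theorem lintegral_eq_transfer [IsManifold (𝓡 2) ∞ S] [CompactSpace S]
    [MeasurableSingletonClass S] {x : S} {m : Measure (NaturalExtension f)}
    (hm : HasPreorbitLaw ρ x m) (hf : ContMDiff (𝓡 2) (𝓡 2) 1 f)
    (hf' : ∀ x, (mfderiv (𝓡 2) (𝓡 2) f x).IsInvertible) (n : ℕ) (g : S → ENNReal) :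
    ∫⁻ z, g (z.1 (-n)) ∂m = transfer ρ f n g x := by
  obtain ⟨s, hs, h⟩ := exists_ae_eq_sum_indicator hm hf hf' n g
  rw [lintegral_congr_ae h, lintegral_finsetSum _ fun y _ =>
    measurable_const.indicator (measurableSet_coordinate_eq _ y), transfer_eq_sum hs]
  refine Finset.sum_congr rfl fun y hy => ?_
  rw [lintegral_indicator_const (measurableSet_coordinate_eq _ y),
    hm.measure_eq n y ((hs y).1 hy), mul_comm]

variable [IsManifold (𝓡 2) ∞ S]
  [IsContMDiffRiemannianBundle (𝓡 2) ∞ Plane (fun x : S => TangentSpace (𝓡 2) x)]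
  [T2Space S] [CompactSpace S] [BorelSpace S]
  {μ : Measure S} [IsProbabilityMeasure μ]
  {μ' : Measure (NaturalExtension f)} {κ : Kernel S (NaturalExtension f)}

/-- Regularity concerns every preimage, not almost every point. Since `x_{-n}` has law `μ`, almost
every `κ x` gives no mass to `x_{-n}` lying in the null set of bad points; as each preimage carries
positive mass, none is bad. -/
theorem ae_isRegular (hμ : IsSmoothVolume ρ μ) (hf : ContMDiff (𝓡 2) (𝓡 2) 1 f)
    (hf' : ∀ x, (mfderiv (𝓡 2) (𝓡 2) f x).IsInvertible) (hlift : IsLift μ μ')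
    (hκ : IsDisintegration μ μ' κ) :
    ∀ᵐ x ∂μ, HasPreorbitLaw ρ x (κ x) ∧ IsRegular ρ f x := by
  have := hκ.isMarkovKernel
  have hlaw : ∀ᵐ x ∂μ, HasPreorbitLaw ρ x (κ x) := by
    filter_upwards [ae_law hμ hf hf' hlift hκ, hκ.ae_fibre] with x h1 h2 using ⟨h2, h1⟩
  have hone : ∀ᵐ x ∂μ, ∀ m, transfer ρ f m (fun _ => 1) x = 1 := by
    filter_upwards [hlaw] with x hx m
    rw [← lintegral_eq_transfer hx hf hf' m fun _ => 1]
    simp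
  set Z := toMeasurable μ {x | ¬ ∀ m, transfer ρ f m (fun _ => 1) x = 1}
  have hZ : MeasurableSet Z := measurableSet_toMeasurable _ _
  have hZ0 : μ Z = 0 := (measure_toMeasurable _).trans (ae_iff.1 hone)
  have hZn : ∀ᵐ x ∂μ, ∀ n : ℕ, κ x {z | z.1 (-n) ∈ Z} = 0 := by
    refine ae_all_iff.2 fun n => ?_
    have hmeas : MeasurableSet {z : NaturalExtension f | z.1 (-n) ∈ Z} :=
      measurable_coordinate _ hZ
    have h1 := hκ.lintegral_eq _ hmeas
    rw [hlift.2 (-n) (by simp) Z hZ, hZ0] at h1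
    exact (lintegral_eq_zero_iff (κ.measurable_coe hmeas)).1 h1.symm
  filter_upwards [hlaw, hZn] with x hx hxZ
  refine ⟨hx, fun n y hy => ?_⟩
  by_contra h
  have hyZ : y ∈ Z := subset_toMeasurable _ _ h
  have h1 : κ x {z | z.1 (-n) = y} = 0 :=
    measure_mono_null (fun z (hz : z.1 (-n) = y) => (hz ▸ hyZ : z.1 (-n) ∈ Z)) (hxZ n)
  rw [hx.measure_eq n y hy, ENNReal.ofReal_eq_zero] at h1
  exact absurd h1 (not_le.2 (one_div_pos.2
    (absDet_pos hμ.pos (isInvertible_mfderiv_iterate hf hf' n y))))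

end Regularity

/-! ### The unstable line of a single orbit -/

section Orbit

theorem iterate_coordinate {S : Type*} {f : S → S} (z : NaturalExtension f) (n k : ℕ) :
    f^[k] (z.1 (-((n + k : ℕ) : ℤ))) = z.1 (-n) := by
  induction k with
  | zero => rfl
  | succ k ih =>
    have h := z.2 (-((n + k : ℕ) : ℤ))
    have h' : -((n + k : ℕ) : ℤ) - 1 = -((n + (k + 1) : ℕ) : ℤ) := by push_cast; ring
    rw [h'] at h
    rw [Function.iterate_succ_apply, h, ih]

theorem finrank_tangentSpace {S : Type*} [TopologicalSpace S] [ChartedSpace Plane S] (x : S) : Module.finrank ℝ (TangentSpace (𝓡 2) x) = 2 :=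
  finrank_euclideanSpace_fin (𝕜 := ℝ) (n := 2)

variable {S : Type*} [TopologicalSpace S] [ChartedSpace Plane S]
  [RiemannianBundle (fun x : S => TangentSpace (𝓡 2) x)] {ρ : S → ℝ} {f : S → S}

theorem inner_pullBack_zero {x y : S} (h : f^[0] y = x) (v w : TangentSpace (𝓡 2) x) :
    inner ℝ (pullBack f 0 h v) (pullBack f 0 h w) = inner ℝ v w := by
  have key : ∀ (F : S → S) (_ : F = id) (h : F y = x),
      inner ℝ ((mfderiv (𝓡 2) (𝓡 2) F y).inverse (tangentCast h.symm v))
        ((mfderiv (𝓡 2) (𝓡 2) F y).inverse (tangentCast h.symm w)) = inner ℝ v w := by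
    rintro _ rfl h
    subst h
    rw [mfderiv_id, ContinuousLinearMap.inverse_id]
    rfl
  exact key _ f.iterate_zero h

theorem backward_succ (hf : ContMDiff (𝓡 2) (𝓡 2) 1 f)
    (hf' : ∀ x, (mfderiv (𝓡 2) (𝓡 2) f x).IsInvertible) (z : NaturalExtension f) (n : ℕ)
    (v : TangentSpace (𝓡 2) (z.1 0)) :
    backward z (n + 1) v = pullBackLin f 1 (iterate_coordinate z n 1) (backward z n v) :=
  pullBack_add hf hf' (iterate_coordinate z n 1) (z.iterate_apply n) (z.iterate_apply (n + 1)) v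

theorem backNorm_coordinate (z : NaturalExtension f) (n : ℕ) (v : TangentSpace (𝓡 2) (z.1 0)) :
    backNorm f n (z.1 0) v (z.1 (-n)) = ‖backward z n v‖ := backNorm_eq f (z.iterate_apply n) v

theorem exists_orthonormalBasis {x : S} {v : TangentSpace (𝓡 2) x} (hv : ‖v‖ = 1) :
    ∃ b : OrthonormalBasis (Fin 2) ℝ (TangentSpace (𝓡 2) x), b 0 = v := by
  have h : Orthonormal ℝ (({0} : Set (Fin 2)).domRestrict fun _ => v) := by
    refine ⟨fun _ => hv, fun i j hij => absurd (Subsingleton.elim i j) hij⟩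
  obtain ⟨b, hb⟩ := h.exists_orthonormalBasis_extension_of_card_eq
    (by rw [finrank_tangentSpace, Fintype.card_fin])
  exact ⟨b, hb 0 rfl⟩

/-- Along an orbit whose past does not contract the vector `b 0`, with
enough uniformity, the unstable space is a line, whose slope with respect to `b` is controlled. -/
theorem unstableSpace_eq_span (hf : ContMDiff (𝓡 2) (𝓡 2) 1 f)
    (hf' : ∀ x, (mfderiv (𝓡 2) (𝓡 2) f x).IsInvertible)
    {L : ℝ} (hL1 : 1 ≤ L) (hL : ∀ (y : S) (u : TangentSpace (𝓡 2) y),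
      ‖mfderiv (𝓡 2) (𝓡 2) f y u‖ ≤ L * ‖u‖ ∧ ‖u‖ ≤ L * ‖mfderiv (𝓡 2) (𝓡 2) f y u‖)
    (z : NaturalExtension f) (b : OrthonormalBasis (Fin 2) ℝ (TangentSpace (𝓡 2) (z.1 0)))
    {K M c : ℝ} (hK0 : 0 ≤ K) (hM : 0 ≤ M) (hc : 0 < c)
    (hK : ∀ n, ‖backward z n (b 0)‖ ^ 2 * ‖backward z n (b 1)‖ ^ 2 -
      inner ℝ (backward z n (b 0)) (backward z n (b 1)) ^ 2 ≤ K ^ 2)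
    (h : ∀ n k : ℕ, ‖backward z n (b 0)‖ ≤
      M * Real.exp (c / 4 * n) * Real.exp (-c * k) * ‖backward z (n + k) (b 0)‖) :
    ∃ T : ℝ, unstableSpace z = ℝ ∙ (b 1 - T • b 0) ∧
      Summable (fun n => (‖backward z n (b 0)‖ ^ 2)⁻¹) ∧
      |T| ≤ L ^ 2 * K * ∑' n, (‖backward z n (b 0)‖ ^ 2)⁻¹ := by
  have hb : ‖b 0‖ = 1 := b.norm_eq_one 0
  have hb0 : b 0 ≠ 0 := norm_ne_zero_iff.1 (hb ▸ one_ne_zero)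
  have hbb : inner ℝ (b 0) (b 1) = 0 := b.inner_eq_zero (by decide)
  have hne : ∀ n, backward z n (b 0) ≠ 0 := fun n =>
    pullBack_ne_zero (isInvertible_mfderiv_iterate hf hf' n) (z.iterate_apply n) hb0
  have hpos : ∀ n, 0 < ‖backward z n (b 0)‖ := fun n => norm_pos_iff.2 (hne n)
  set t : ℕ → ℝ := fun n => slope (backward z n (b 0)) (backward z n (b 1))
  have ht : ∀ n, |t (n + 1) - t n| ≤ L ^ 2 * K / ‖backward z n (b 0)‖ ^ 2 := by
    intro n
    simp only [t]
    rw [backward_succ hf hf', backward_succ hf hf']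
    have hB := norm_pullBack_bounds hf hf' hL1 hL 1 (iterate_coordinate z n 1)
    simp only [pow_one] at hB
    exact abs_slope_map_sub_slope_le _ hK0 (by linarith) (fun u => (hB u).1)
      (fun u => (hB u).2) (hne n) _ (hK n)
  obtain ⟨T, ⟨C, hC⟩, hsum, hT⟩ := exists_slope_limit hpos hc (by positivity) hM ht h
  have ht0 : t 0 = 0 := by
    simp only [t, slope]
    have : inner ℝ (backward z 0 (b 0)) (backward z 0 (b 1)) = (0 : ℝ) :=
      (inner_pullBack_zero _ _ _).trans hbb
    rw [this, zero_div]
  have ha0 : ‖backward z 0 (b 0)‖ = 1 := by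
    have h1 : inner ℝ (backward z 0 (b 0)) (backward z 0 (b 0)) = inner ℝ (b 0) (b 0) :=
      inner_pullBack_zero _ _ _
    rw [real_inner_self_eq_norm_sq, real_inner_self_eq_norm_sq, hb, one_pow] at h1
    exact (pow_eq_one_iff_of_nonneg (norm_nonneg _) two_ne_zero).1 h1
  have hgrow : ∀ n : ℕ, 1 ≤ M * Real.exp (-c * n) * ‖backward z n (b 0)‖ := fun n => by
    have := h 0 n
    have e : ‖backward z (0 + n) (b 0)‖ = ‖backward z n (b 0)‖ :=
      congrArg (fun m => ‖backward z m (b 0)‖) (zero_add n)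
    rw [ha0, e] at this
    simpa using this
  have hM0 : 0 < M := by
    refine hM.lt_of_ne fun h0 => ?_
    have := hgrow 0
    rw [← h0] at this
    norm_num at this
  have hu : b 1 - T • b 0 ∈ unstableSpace z := by
    refine ⟨K * M + C, c / 2, by positivity, fun n => ?_⟩
    -- The first part is the height, of size at most `K` over the length of the image of `b 0`; the
    -- second is governed by the speed of convergence of the slopes.
    have e1 : backward z n (b 1 - T • b 0) = (backward z n (b 1) - t n • backward z n (b 0)) -
        (T - t n) • backward z n (b 0) := by
      change pullBackLin f n (z.iterate_apply n) (b 1 - T • b 0) = _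
      rw [map_sub, map_smul, sub_smul]
      simp only [pullBackLin_apply]
      abel_nf
      rfl
    have e2 := norm_sub_slope_mul_norm_le (hne n) (backward z n (b 1)) hK0 (hK n)
    have e3 : ‖backward z n (b 1) - t n • backward z n (b 0)‖ ≤ K * M * Real.exp (-c * n) := by
      calc _ = ‖backward z n (b 1) - t n • backward z n (b 0)‖ * 1 := (mul_one _).symm
        _ ≤ ‖backward z n (b 1) - t n • backward z n (b 0)‖ *
            (M * Real.exp (-c * n) * ‖backward z n (b 0)‖) := by gcongr; exact hgrow n
        _ = ‖backward z n (b 1) - t n • backward z n (b 0)‖ * ‖backward z n (b 0)‖ *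
            (M * Real.exp (-c * n)) := by ring
        _ ≤ K * (M * Real.exp (-c * n)) := by gcongr
        _ = _ := by ring
    have e4 : Real.exp (-c * n) ≤ Real.exp (-(c / 2) * n) := by
      refine Real.exp_le_exp.2 (mul_le_mul_of_nonneg_right (by linarith) (Nat.cast_nonneg n))
    rw [e1]
    calc _ ≤ K * M * Real.exp (-c * n) + ‖backward z n (b 0)‖ * |T - t n| := by
          refine (norm_sub_le _ _).trans (add_le_add e3 ?_)
          rw [norm_smul, Real.norm_eq_abs, mul_comm]
      _ ≤ K * M * Real.exp (-(c / 2) * n) + C * Real.exp (-(c / 2) * n) := by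
          exact add_le_add (by gcongr) (hC n)
      _ = _ := by ring
  have hv : b 0 ∉ unstableSpace z := by
    rintro ⟨D, d, hd, hD⟩
    have hlim : Filter.Tendsto (fun n : ℕ => M * D * Real.exp (-(c + d) * n))
        Filter.atTop (𝓝 (M * D * 0)) := by
      refine Filter.Tendsto.const_mul _ (Real.tendsto_exp_atBot.comp ?_)
      exact (tendsto_natCast_atTop_atTop (R := ℝ)).const_mul_atTop_of_neg (by linarith)
    rw [mul_zero] at hlim
    refine absurd (ge_of_tendsto' hlim fun n => ?_) (not_le.2 one_pos)
    calc 1 ≤ M * Real.exp (-c * n) * ‖backward z n (b 0)‖ := hgrow n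
      _ ≤ M * Real.exp (-c * n) * (D * Real.exp (-d * n)) := by gcongr; exact hD n
      _ = M * D * Real.exp (-(c + d) * n) := by
          rw [neg_add, add_mul, Real.exp_add]
          ring
  refine ⟨T, le_antisymm (fun w hw => ?_) ?_, hsum, ?_⟩
  · have hw' : w = inner ℝ (b 0) w • b 0 + inner ℝ (b 1) w • b 1 := by
      rw [← Fin.sum_univ_two fun i => inner ℝ (b i) w • b i, b.sum_repr']
    set α := inner ℝ (b 0) w
    set β := inner ℝ (b 1) w
    -- Modulo the unstable vector already found, any `w` is a multiple of `b 0`, which grows in the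
    -- past; hence the coefficient vanishes.
    have hdecomp : (α + β * T) • b 0 = w - β • (b 1 - T • b 0) := by
      rw [hw', smul_sub, smul_smul, add_smul]
      abel
    have hmem : (α + β * T) • b 0 ∈ unstableSpace z := by
      rw [hdecomp]
      exact Submodule.sub_mem _ hw (Submodule.smul_mem _ _ hu)
    have hzero : α + β * T = 0 := by
      by_contra h0
      exact hv ((Submodule.smul_mem_iff _ h0).1 hmem)
    rw [hzero, zero_smul, eq_comm, sub_eq_zero] at hdecomp
    exact Submodule.mem_span_singleton.2 ⟨β, hdecomp.symm⟩
  · rw [Submodule.span_singleton_le_iff_mem]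
    exact hu
  · simpa [ht0] using hT

end Orbit

/-! ### Almost sure growth and the unstable line -/

section Main

variable {S : Type*} {f : S → S} [TopologicalSpace S] [ChartedSpace Plane S]
  [RiemannianBundle (fun x : S => TangentSpace (𝓡 2) x)] {ρ : S → ℝ}

theorem IsRegular.one_div_absDet_le {x y : S} (hx : IsRegular ρ f x) {n : ℕ} (h : f^[n] y = x) :
    1 / absDet ρ f^[n] y ≤ 1 := by
  classical
  have h1 := hx 0 x rfl n
  have h2 := ENNReal.le_tsum (f := fun y => if f^[n] y = x then
    ENNReal.ofReal (1 / absDet ρ f^[n] y) * 1 else 0) y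
  simp only [if_pos h, mul_one] at h2
  refine ENNReal.ofReal_le_one.1 (h2.trans (le_of_eq ?_))
  rw [← h1, transfer]
  refine tsum_congr fun y => ?_
  congr 1
  simp

variable [IsManifold (𝓡 2) ∞ S] [CompactSpace S] [MeasurableSpace S] [MeasurableSingletonClass S]

/-- Let `a_n` be the backward norms. The double series of `e^{-δcn/4} e^{δck} (a_n / a_{n+k})^δ` has
finite mean: the choice of `c` gives `e^{δc} r = r^{1/2} < 1`, and the first factor makes the sum
over `n` converge. Where the series has a finite sum `Y`, each term is at most `Y`, and `M =
Y^{1/δ}` works for all `n` and `k` at once. -/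
theorem ae_exists_uniform_growth (hf : ContMDiff (𝓡 2) (𝓡 2) 1 f)
    (hf' : ∀ x, (mfderiv (𝓡 2) (𝓡 2) f x).IsInvertible) (hρ : ∀ x, 0 < ρ x)
    {x : S} {m : Measure (NaturalExtension f)}
    (hm : HasPreorbitLaw ρ x m) (hx : IsRegular ρ f x) {δ C r : ℝ} (hδ : 0 < δ) (hr : 0 < r)
    (hr1 : r < 1) (hC : 0 < C)
    (h : ∀ x, IsRegular ρ f x → ∀ v : TangentSpace (𝓡 2) x, v ≠ 0 → ∀ n,
        transfer ρ f n (fun y => ENNReal.ofReal (backNorm f n x v y ^ (-δ))) x ≤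
          ENNReal.ofReal (C * r ^ n * ‖v‖ ^ (-δ)))
    {v : TangentSpace (𝓡 2) x} (hv : v ≠ 0) {c : ℝ} (hc : c = -Real.log r / (2 * δ)) :
    ∀ᵐ z ∂m, ∃ M : ℝ, 0 ≤ M ∧ ∀ n k : ℕ, backNorm f n x v (z.1 (-n)) ≤
      M * Real.exp (c / 4 * n) * Real.exp (-c * k) *
        backNorm f (n + k) x v (z.1 (-((n + k : ℕ) : ℤ))) := by
  have hc0 : 0 < c := by
    rw [hc]
    exact div_pos (neg_pos.2 (Real.log_neg hr hr1)) (by positivity)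
  set q : ℝ := Real.exp (-(δ * c / 4))
  set p : ℝ := Real.exp (δ * c)
  have hq0 : 0 < q := Real.exp_pos _
  have hq1 : q < 1 := Real.exp_lt_one_iff.2 (neg_lt_zero.2 (by positivity))
  have hp0 : 0 < p := Real.exp_pos _
  have hpr : p * r < 1 := by
    have : p * r = Real.exp (δ * c + Real.log r) := by rw [Real.exp_add, Real.exp_log hr]
    rw [this, Real.exp_lt_one_iff, hc]
    have := Real.log_neg hr hr1
    field_simp
    linarith
  set R : ℕ → ℕ → S → ENNReal := fun n k z => ENNReal.ofReal
    ((backNorm f n x v (f^[k] z) / backNorm f (n + k) x v z) ^ δ)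
  set F : ℕ → ℕ → NaturalExtension f → ENNReal := fun n k z =>
    ENNReal.ofReal (q ^ n * p ^ k) * R n k (z.1 (-((n + k : ℕ) : ℤ)))
  have hRm : ∀ n k, AEMeasurable (fun z : NaturalExtension f =>
      R n k (z.1 (-((n + k : ℕ) : ℤ)))) m := fun n k =>
    aemeasurable_comp_coordinate hm hf hf' (n + k) (R n k)
  have hFm : ∀ n k, AEMeasurable (F n k) m := fun n k => (hRm n k).const_mul _
  have hFi : ∀ n k, ∫⁻ z, F n k z ∂m ≤
      ENNReal.ofReal C * (ENNReal.ofReal q ^ n * ENNReal.ofReal (p * r) ^ k) := by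
    intro n k
    rw [lintegral_const_mul'' _ (hRm n k), lintegral_eq_transfer hm hf hf' (n + k) (R n k)]
    calc _ ≤ ENNReal.ofReal (q ^ n * p ^ k) * ENNReal.ofReal (C * r ^ k) := by
          gcongr
          exact transfer_ratio_le hρ hf hf' hx h hv n k
      _ = _ := by
          rw [← ENNReal.ofReal_pow hq0.le, ← ENNReal.ofReal_pow (by positivity),
            ← ENNReal.ofReal_mul (by positivity), ← ENNReal.ofReal_mul (by positivity),
            ← ENNReal.ofReal_mul hC.le]
          congr 1
          ring
  have hfin : ∫⁻ z, ∑' n, ∑' k, F n k z ∂m ≠ ⊤ := by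
    rw [lintegral_tsum fun n => AEMeasurable.tsum (hFm n)]
    have e1 : ∀ n, ∫⁻ z, ∑' k, F n k z ∂m = ∑' k, ∫⁻ z, F n k z ∂m := fun n =>
      lintegral_tsum (hFm n)
    simp only [e1]
    refine ne_top_of_le_ne_top ?_
      (ENNReal.tsum_le_tsum fun n => ENNReal.tsum_le_tsum fun k => hFi n k)
    simp only [ENNReal.tsum_mul_left, ENNReal.tsum_mul_right, ENNReal.tsum_geometric]
    have g1 : ∀ s : ℝ, s < 1 → (1 - ENNReal.ofReal s)⁻¹ ≠ ⊤ := fun s hs => by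
      rw [Ne, ENNReal.inv_eq_top, tsub_eq_zero_iff_le, not_le, ENNReal.ofReal_lt_one]
      exact hs
    exact ENNReal.mul_ne_top ENNReal.ofReal_ne_top (ENNReal.mul_ne_top (g1 _ hq1) (g1 _ hpr))
  have hae := ae_lt_top' (AEMeasurable.tsum fun n =>
    AEMeasurable.tsum (hFm n)) hfin
  filter_upwards [hae, hm.ae_eq] with z hz hz0
  set Y := ∑' n, ∑' k, F n k z
  refine ⟨Y.toReal ^ (1 / δ), by positivity, fun n k => ?_⟩
  have hit : ∀ n : ℕ, f^[n] (z.1 (-n)) = x := fun n => by rw [z.iterate_apply, hz0]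
  have ha := backNorm_pos hf hf' (hit n) hv
  have hb := backNorm_pos hf hf' (hit (n + k)) hv
  have hle : F n k z ≤ Y := (ENNReal.le_tsum k).trans (ENNReal.le_tsum (f := fun n =>
    ∑' k, F n k z) n)
  simp only [F, R] at hle
  rw [iterate_coordinate, ← ENNReal.ofReal_mul (by positivity)] at hle
  have hle' := (ENNReal.ofReal_le_iff_le_toReal hz.ne).1 hle
  set a := backNorm f n x v (z.1 (-n))
  set b := backNorm f (n + k) x v (z.1 (-((n + k : ℕ) : ℤ)))
  have hroot : (q ^ n * p ^ k * (a / b) ^ δ) ^ (1 / δ) ≤ Y.toReal ^ (1 / δ) :=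
    Real.rpow_le_rpow (by positivity) hle' (by positivity)
  have e2 : (q ^ n * p ^ k * (a / b) ^ δ) ^ (1 / δ) =
      Real.exp (-(c / 4 * n)) * Real.exp (c * k) * (a / b) := by
    have e3 : q ^ n * p ^ k = (Real.exp (-(c / 4 * n)) * Real.exp (c * k)) ^ δ := by
      rw [← Real.exp_nat_mul, ← Real.exp_nat_mul, ← Real.exp_add, ← Real.exp_add, ← Real.exp_mul]
      congr 1
      ring
    rw [e3, ← Real.mul_rpow (by positivity) (by positivity), ← Real.rpow_mul (by positivity),
      mul_one_div_cancel hδ.ne', Real.rpow_one]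
  rw [e2] at hroot
  calc a = (Real.exp (-(c / 4 * n)) * Real.exp (c * k) * (a / b)) *
        (Real.exp (c / 4 * n) * Real.exp (-c * k) * b) := by
        rw [Real.exp_neg, neg_mul, Real.exp_neg]
        field_simp
    _ ≤ Y.toReal ^ (1 / δ) * (Real.exp (c / 4 * n) * Real.exp (-c * k) * b) := by gcongr
    _ = _ := by ring

/-- Almost surely the unstable space is a line, whose slope with respect to an orthonormal basis `b`
is bounded by the sum of the inverse squares of the backward growth of `b 0`. -/
theorem ae_unstableSpace (hf : ContMDiff (𝓡 2) (𝓡 2) 1 f)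
    (hf' : ∀ x, (mfderiv (𝓡 2) (𝓡 2) f x).IsInvertible) (hρ : ∀ x, 0 < ρ x)
    {L : ℝ} (hL1 : 1 ≤ L) (hL : ∀ (y : S) (u : TangentSpace (𝓡 2) y),
      ‖mfderiv (𝓡 2) (𝓡 2) f y u‖ ≤ L * ‖u‖ ∧ ‖u‖ ≤ L * ‖mfderiv (𝓡 2) (𝓡 2) f y u‖)
    {K : ℝ} (hK : ∀ x y, ρ x / ρ y ≤ K)
    {x : S} {m : Measure (NaturalExtension f)}
    (hm : HasPreorbitLaw ρ x m) (hx : IsRegular ρ f x) {δ C r : ℝ} (hδ : 0 < δ) (hr : 0 < r)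
    (hr1 : r < 1) (hC : 0 < C)
    (h : ∀ x, IsRegular ρ f x → ∀ v : TangentSpace (𝓡 2) x, v ≠ 0 → ∀ n,
        transfer ρ f n (fun y => ENNReal.ofReal (backNorm f n x v y ^ (-δ))) x ≤
          ENNReal.ofReal (C * r ^ n * ‖v‖ ^ (-δ)))
    (b : OrthonormalBasis (Fin 2) ℝ (TangentSpace (𝓡 2) x)) :
    ∀ᵐ z ∂m, ∃ (h0 : z.1 0 = x) (T : ℝ),
      (unstableSpace z).map (tangentCast h0).toLinearEquiv.toLinearMap = ℝ ∙ (b 1 - T • b 0) ∧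
      Module.finrank ℝ (unstableSpace z) = 1 ∧
      |T| ≤ L ^ 2 * K * ∑' n : ℕ, (backNorm f n x (b 0) (z.1 (-n)) ^ 2)⁻¹ := by
  have hb0 : b 0 ≠ 0 := norm_ne_zero_iff.1 (b.norm_eq_one 0 ▸ one_ne_zero)
  have hK0 : 0 ≤ K := (div_pos (hρ x) (hρ x)).le.trans (hK x x)
  filter_upwards [hm.ae_eq, ae_exists_uniform_growth hf hf' hρ hm hx hδ hr hr1 hC h hb0 rfl]
    with z hz0 ⟨M, hM, hz⟩
  subst hz0
  simp only [backNorm_coordinate] at hz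
  -- Areas do not blow up in the past: each weight `1/|det df^n|` is at most the total mass `1`, and
  -- the ratio of densities is at most `K`.
  have hgram : ∀ n, ‖backward z n (b 0)‖ ^ 2 * ‖backward z n (b 1)‖ ^ 2 -
      inner ℝ (backward z n (b 0)) (backward z n (b 1)) ^ 2 ≤ K ^ 2 := fun n => by
    have hfn := isInvertible_mfderiv_iterate hf hf' n (z.1 (-n))
    refine (gram_pullBack hρ hfn (z.iterate_apply n) b).trans ?_
    have h1 := hx.one_div_absDet_le (z.iterate_apply n)
    have h2 := absDet_pos hρ hfn
    have h3 := div_pos (hρ (z.1 0)) (hρ (z.1 (-n)))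
    gcongr
    calc _ = ρ (z.1 0) / ρ (z.1 (-n)) * (1 / absDet ρ f^[n] (z.1 (-n))) := by
          rw [div_eq_mul_one_div]
      _ ≤ K * 1 := by
          gcongr
          exact hK _ _
      _ = K := mul_one K
  have hc : 0 < -Real.log r / (2 * δ) :=
    div_pos (neg_pos.2 (Real.log_neg hr hr1)) (by positivity)
  obtain ⟨T, hT, -, hT'⟩ := unstableSpace_eq_span hf hf' hL1 hL z b hK0 hM hc hgram hz
  refine ⟨rfl, T, ?_, ?_, by simpa only [backNorm_coordinate] using hT'⟩
  · rw [hT]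
    exact Submodule.map_id _
  · rw [hT]
    refine finrank_span_singleton fun h0 => ?_
    have h1 : inner ℝ (b 1) (b 1 - T • b 0) = (1 : ℝ) := by
      rw [inner_sub_right, inner_smul_right, b.inner_eq_one, b.inner_eq_zero (by decide)]
      ring
    rw [h0, inner_zero_right] at h1
    exact zero_ne_one h1

end Main

/-! ### The angle estimate -/

section Angle

theorem exists_div_le {S : Type*} [TopologicalSpace S] [CompactSpace S] {ρ : S → ℝ}
    (hρc : Continuous ρ) (hρ : ∀ x, 0 < ρ x) : ∃ K, ∀ x y, ρ x / ρ y ≤ K := by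
  have hc : Continuous fun q : S × S => ρ q.1 / ρ q.2 :=
    (hρc.comp continuous_fst).div (hρc.comp continuous_snd) fun q => (hρ q.2).ne'
  obtain ⟨K, hK⟩ := isCompact_univ.exists_bound_of_continuousOn hc.continuousOn
  exact ⟨K, fun x y => (le_abs_self _).trans (hK (x, y) trivial)⟩

variable {S : Type*} {f : S → S} [TopologicalSpace S] [ChartedSpace Plane S]
  [RiemannianBundle (fun x : S => TangentSpace (𝓡 2) x)] {ρ : S → ℝ}
  [IsManifold (𝓡 2) ∞ S] [CompactSpace S] [MeasurableSpace S] [MeasurableSingletonClass S]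

/-- With `b 0` spanning `E`, a small angle means a large slope `T`, which forces the sum `Y` of the
`a_n^{-δ}` to be at least `ε`. Its mean is bounded by a geometric series, so Markov's inequality
concludes. -/
theorem measure_unstableNear_le (hf : ContMDiff (𝓡 2) (𝓡 2) 1 f)
    (hf' : ∀ x, (mfderiv (𝓡 2) (𝓡 2) f x).IsInvertible) (hρ : ∀ x, 0 < ρ x)
    {L : ℝ} (hL1 : 1 ≤ L) (hL : ∀ (y : S) (u : TangentSpace (𝓡 2) y),
      ‖mfderiv (𝓡 2) (𝓡 2) f y u‖ ≤ L * ‖u‖ ∧ ‖u‖ ≤ L * ‖mfderiv (𝓡 2) (𝓡 2) f y u‖)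
    {K : ℝ} (hK : ∀ x y, ρ x / ρ y ≤ K)
    {x : S} {m : Measure (NaturalExtension f)}
    (hm : HasPreorbitLaw ρ x m) (hx : IsRegular ρ f x) {δ C r : ℝ} (hδ : 0 < δ) (hδ2 : δ ≤ 2)
    (hr : 0 < r) (hr1 : r < 1) (hC : 0 < C)
    (h : ∀ x, IsRegular ρ f x → ∀ v : TangentSpace (𝓡 2) x, v ≠ 0 → ∀ n,
        transfer ρ f n (fun y => ENNReal.ofReal (backNorm f n x v y ^ (-δ))) x ≤
          ENNReal.ofReal (C * r ^ n * ‖v‖ ^ (-δ)))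
    (E : ℙ ℝ (TangentSpace (𝓡 2) x)) {η : ℝ} (hη : 0 < η) (hη1 : η ≤ 1) :
    m (unstableNear f x E η) ≤
      ENNReal.ofReal (C / (1 - r) * (1 + L ^ 2 * K) ^ (δ / 2) * η ^ (δ / 2)) := by
  have hK0 : 0 ≤ K := (div_pos (hρ x) (hρ x)).le.trans (hK x x)
  have hErep : 0 < ‖E.rep‖ := norm_pos_iff.2 E.rep_nonzero
  obtain ⟨b, hb⟩ := exists_orthonormalBasis (v := ‖E.rep‖⁻¹ • E.rep) (by
    rw [norm_smul, norm_inv, norm_norm, inv_mul_cancel₀ hErep.ne'])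
  have hE : E.submodule = ℝ ∙ b 0 := by
    rw [E.submodule_eq, hb, Submodule.span_singleton_smul_eq
      (IsUnit.mk0 _ (inv_ne_zero hErep.ne'))]
  have hbn : ∀ i, ‖b i‖ = 1 := b.norm_eq_one
  have hb0 : b 0 ≠ 0 := norm_ne_zero_iff.1 (hbn 0 ▸ one_ne_zero)
  set D : ℝ := 1 + L ^ 2 * K
  have hD : 1 ≤ D := le_add_of_nonneg_right (by positivity)
  set G : ℕ → S → ENNReal := fun n y => ENNReal.ofReal (backNorm f n x (b 0) y ^ (-δ))
  set Y : NaturalExtension f → ENNReal := fun z => ∑' n : ℕ, G n (z.1 (-n))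
  have hGm : ∀ n : ℕ, AEMeasurable (fun z : NaturalExtension f => G n (z.1 (-n))) m := fun n =>
    aemeasurable_comp_coordinate hm hf hf' n (G n)
  have hYi : ∫⁻ z, Y z ∂m ≤ ENNReal.ofReal (C / (1 - r)) := by
    rw [lintegral_tsum hGm]
    calc _ ≤ ∑' n : ℕ, ENNReal.ofReal C * ENNReal.ofReal r ^ n := by
          refine ENNReal.tsum_le_tsum fun n => ?_
          rw [lintegral_eq_transfer hm hf hf' n (G n), ← ENNReal.ofReal_pow hr.le,
            ← ENNReal.ofReal_mul hC.le]
          simpa [hbn] using h x hx (b 0) hb0 n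
      _ = _ := by
          rw [ENNReal.tsum_mul_left, ENNReal.tsum_geometric, ENNReal.ofReal_div_of_pos (by linarith),
            ENNReal.ofReal_sub _ hr.le, ENNReal.ofReal_one, div_eq_mul_inv]
  set ε : ℝ := (1 / (D * η)) ^ (δ / 2)
  have hε : 0 < ε := by positivity
  have hsub : unstableNear f x E η ≤ᵐ[m] {z | ENNReal.ofReal ε ≤ Y z} := by
    filter_upwards [ae_unstableSpace hf hf' hρ hL1 hL hK hm hx hδ hr hr1 hC h b]
      with z ⟨h0, T, hT, _, hT'⟩ ⟨h1, F, hF, hEF⟩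
    have hFT : F.submodule = ℝ ∙ (b 1 - T • b 0) := hF.trans hT
    have hlt := one_lt_of_lineAngle_lt (hbn 0) (hbn 1) (b.inner_eq_zero (by decide)) hη hη1 hE hFT
      hEF
    change ENNReal.ofReal ε ≤ Y z
    by_cases hYz : Y z = ⊤
    · rw [hYz]
      exact le_top
    have hit : ∀ n : ℕ, f^[n] (z.1 (-n)) = x := fun n => by rw [z.iterate_apply, h0]
    set a : ℕ → ℝ := fun n => backNorm f n x (b 0) (z.1 (-n)) with ha
    have hapos : ∀ n, 0 < a n := fun n => backNorm_pos hf hf' (hit n) hb0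
    have hrpos : ∀ n, 0 ≤ a n ^ (-δ) := fun n => Real.rpow_nonneg (hapos n).le _
    have hYa : Y z = ∑' n, ENNReal.ofReal (a n ^ (-δ)) := rfl
    have hsum : Summable fun n => a n ^ (-δ) := by
      have := ENNReal.summable_toReal (hYa ▸ hYz)
      simpa only [ENNReal.toReal_ofReal (hrpos _)] using this
    have hYr : Y z = ENNReal.ofReal (∑' n, a n ^ (-δ)) := by
      rw [hYa, ENNReal.ofReal_tsum_of_nonneg hrpos hsum]
    set Z := ∑' n, a n ^ (-δ)
    -- The term `n = 0` gives `Z ≥ 1`, which lets the `1` in `1 + |T|` be absorbed: `1 + |T| ≤ D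
    -- Z^{2/δ}`.
    have ha0 : a 0 = 1 := by
      have := norm_pullBack_bounds hf hf' hL1 hL 0 (hit 0) (b 0)
      rw [pow_zero, one_mul, one_mul, hbn, ← backNorm_eq] at this
      exact le_antisymm this.1 this.2
    have hZ1 : 1 ≤ Z := by
      have := hsum.le_tsum 0 fun n _ => hrpos n
      rwa [ha0, Real.one_rpow] at this
    have hZp : 1 ≤ Z ^ (2 / δ) := Real.one_le_rpow hZ1 (by positivity)
    have hTZ : |T| ≤ L ^ 2 * K * Z ^ (2 / δ) :=
      hT'.trans (mul_le_mul_of_nonneg_left (tsum_inv_sq_le hapos hδ hδ2 hsum le_rfl)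
        (by positivity))
    have hDZ : 1 / (D * η) ≤ Z ^ (2 / δ) := by
      have e1 : 1 < (η * (1 + |T|)) ^ 2 := by
        have := sq_abs T
        have := abs_nonneg T
        nlinarith [mul_nonneg (sq_nonneg η) (abs_nonneg T)]
      have e2 : 1 < η * (1 + |T|) := (one_lt_sq_iff₀ (by positivity)).1 e1
      rw [div_le_iff₀ (by positivity)]
      calc 1 ≤ η * (1 + |T|) := e2.le
        _ ≤ η * (Z ^ (2 / δ) + L ^ 2 * K * Z ^ (2 / δ)) := by gcongr
        _ = _ := by ring
    rw [hYr]
    refine ENNReal.ofReal_le_ofReal ?_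
    calc ε ≤ (Z ^ (2 / δ)) ^ (δ / 2) := Real.rpow_le_rpow (by positivity) hDZ (by positivity)
      _ = Z := by
          rw [← Real.rpow_mul (by linarith)]
          have : 2 / δ * (δ / 2) = 1 := by field_simp
          rw [this, Real.rpow_one]
  calc m (unstableNear f x E η) ≤ m {z | ENNReal.ofReal ε ≤ Y z} := measure_mono_ae hsub
    _ ≤ (∫⁻ z, Y z ∂m) / ENNReal.ofReal ε :=
        meas_ge_le_lintegral_div (AEMeasurable.tsum hGm)
          (ENNReal.ofReal_pos.2 hε).ne' ENNReal.ofReal_ne_top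
    _ ≤ ENNReal.ofReal (C / (1 - r)) / ENNReal.ofReal ε := by gcongr
    _ = _ := by
        rw [← ENNReal.ofReal_div_of_pos hε]
        congr 1
        simp only [ε]
        rw [Real.div_rpow zero_le_one (by positivity), Real.one_rpow, div_div_eq_mul_div, div_one,
          Real.mul_rpow (by positivity) hη.le, mul_assoc]

end Angle

end UnstableAngle

end

/-! ### Choice of the constants and conclusion -/

open UnstableAngle in
theorem theorem7p1 {S : Type*} [TopologicalSpace S] [ChartedSpace Plane S]
    [IsManifold (𝓡 2) ∞ S] [T2Space S] [CompactSpace S] [MeasurableSpace S] [BorelSpace S]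
    [RiemannianBundle (fun x : S => TangentSpace (𝓡 2) x)]
    [IsContMDiffRiemannianBundle (𝓡 2) ∞ Plane (fun x : S => TangentSpace (𝓡 2) x)]
    (μ : Measure S) [IsProbabilityMeasure μ] (ρ : S → ℝ) (hμ : IsSmoothVolume ρ μ)
    (f : S → S) (hf : MemU ρ μ f) :
    ∃ A β : ℝ, 0 < A ∧ 0 < β ∧
      ∀ (μ' : Measure (NaturalExtension f)) (κ : Kernel S (NaturalExtension f)),
        IsLift μ μ' → IsDisintegration μ μ' κ →
          ∀ᵐ x ∂μ,
            (∀ᵐ y ∂κ x, Module.finrank ℝ (unstableSpace y) = 1) ∧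
            ∀ (E : ℙ ℝ (TangentSpace (𝓡 2) x)) (η : ℝ), 0 < η →
              κ x (unstableNear f x E η) ≤ ENNReal.ofReal (A * η ^ β) := by
  have hρ := hμ.pos
  have hf1 := hf.contMDiff
  have hf' := hf.isInvertible
  obtain ⟨L, hL1, hL⟩ := exists_norm_bounds hf1 hf'
  obtain ⟨K, hK⟩ := exists_div_le hμ.contMDiff.continuous hρ
  obtain ⟨N, δ, q, hN, hδ, hδ2, hq, hq1, hstep⟩ :=
    exists_transfer_contraction hρ hf1 hf' hf.rate_pos hL1 hL
  obtain ⟨C, r, hC, hr, hr1, hmom⟩ :=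
    exists_moment_bound hρ hf1 hf' hL1 hL hN hδ hq hq1 hstep
  -- The maximum with `1` makes the bound trivial for `η > 1`, where the angle estimate does not
  -- apply.
  refine ⟨max 1 (C / (1 - r) * (1 + L ^ 2 * K) ^ (δ / 2)), δ / 2, lt_max_of_lt_left one_pos,
    by positivity, fun μ' κ hlift hκ => ?_⟩
  have := hκ.isMarkovKernel
  filter_upwards [ae_isRegular hμ hf1 hf' hlift hκ] with x ⟨hlaw, hreg⟩
  constructor
  · obtain ⟨e, he⟩ : ∃ e : TangentSpace (𝓡 2) x, ‖e‖ = 1 := by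
      let b := (stdOrthonormalBasis ℝ (TangentSpace (𝓡 2) x)).reindex
        (finCongr (finrank_tangentSpace x))
      exact ⟨b 0, b.norm_eq_one 0⟩
    obtain ⟨b, -⟩ := exists_orthonormalBasis he
    filter_upwards [ae_unstableSpace hf1 hf' hρ hL1 hL hK hlaw hreg hδ hr hr1 hC hmom b]
      with z ⟨_, _, _, hz, _⟩ using hz
  · intro E η hη
    rcases le_or_gt η 1 with h1 | h1
    · refine (measure_unstableNear_le hf1 hf' hρ hL1 hL hK hlaw hreg hδ hδ2 hr hr1 hC hmom E hη
        h1).trans (ENNReal.ofReal_le_ofReal ?_)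
      gcongr
      exact le_max_right _ _
    · refine prob_le_one.trans (ENNReal.one_le_ofReal.2 ?_)
      exact one_le_mul_of_one_le_of_one_le (le_max_left _ _)
        (Real.one_le_rpow h1.le (by positivity))
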